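/- Let $\mathbb D=\{z\in\mathbb C:|z|<1\}$, let $\mathbb U\subset\mathbb C$ be an open set conformally equivalent to $\mathbb D$, and let $\Sigma$ be a complex Banach space. Let $A^\infty$ be the Fréchet algebra of analytic functions $a(z)=\sum_{k\ge 0}c_kz^k$ on $\mathbb D$ whose Taylor coefficients are rapidly decreasing, with the topology generated by the norms $|a|_m=\sup_{k\ge 0}|c_k|(k+1)^m$, $m=0,1,2,\dots$. Put $A^\infty_{\mathbb U}=\{a\circ\psi: a\in A^\infty\}$, with the topology transported from $A^\infty$, where $\psi:\mathbb U\to\mathbb D$ is a conformal equivalence (neither the algebra nor its topology depends on the choice of $\psi$). A Banach space $\mathscr F$ of analytic functions $\mathbb U\to\Sigma$ is called *acceptable* if (a) for every $z\in\mathbb U$ the evaluation $\delta_z:\mathscr F\to\Sigma$, $f\mapsto f(z)$, is continuous; (b) $\mathscr F$ is a module over $A^\infty_{\mathbb U}$ under pointwise multiplication, and the product $A^\infty_{\mathbb U}\times\mathscr F\to\mathscr F$ is jointly continuous; (c) for every conformal equivalence $\varphi:\mathbb U\to\mathbb D$ there is a constant $K[\varphi]>0$ such that, for every analytic $f:\mathbb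 U\to\Sigma$, one has $\varphi f\in\mathscr F$ if and only if $f\in\mathscr F$, and in that case $K[\varphi]^{-1}\|\varphi f\|_{\mathscr F}\le\|f\|_{\mathscr F}\le K[\varphi]\|\varphi f\|_{\mathscr F}$. For $u\in\mathbb U$ let $\mathscr F_u=\{f(u): f\in\mathscr F\}$ with the quotient norm $\|w\|_{\mathscr F_u}=\inf\{\|f\|_{\mathscr F}: f\in\mathscr F,\ f(u)=w\}$. For an analytic $f:\mathbb U\to\Sigma$ and $n\ge 1$ let $$\tau_{(n,0]}f=\Big(\frac{f^{(n-1)}}{(n-1)!},\dots,f',f\Big):\mathbb U\to\Sigma^n ,$$ and let the Rochberg space $\mathscr F^{(n)}_u=\{\tau_{(n,0]}f(u): f\in\mathscr F\}\subset\Sigma^n$ carry the quotient norm $\|w\|=\inf\{\|f\|_{\mathscr F}: f\in\mathscr F,\ \tau_{(n,0]}f(u)=w\}$. **Theorem.** Let $\mathscr F$ be an acceptable space of analytic functions $\mathbb U\to\Sigma$. For every $n\ge 2$ there is an acceptable space $\mathscr T$ of analytic functions $\mathbb U\to\Sigma^n$ such that * for every $f\in\mathscr F$, $\tau_{(n,0]}f$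 belongs to $\mathscr T$ and $\|\tau_{(n,0]}f\|_{\mathscr T}=\|f\|_{\mathscr F}$; * for every $u\in\mathbb U$, $\mathscr T_u=\mathscr F^{(n)}_u$ as subspaces of $\Sigma^n$, with equivalent norms (with constants that may depend on $u$). -/

import Mathlib

open Set Filter Topology

noncomputable section

/-- The open unit disc. -/
def unitDisc : Set ℂ := Metric.ball 0 1

/-- `φ` restricts to a conformal equivalence from `U` onto `V`: it is holomorphic on `U` and has
a holomorphic two-sided inverse `χ : V → U`. The values of `φ` off `U` are irrelevant. -/
def IsConformalEquiv (U V : Set ℂ) (φ : ℂ → ℂ) : Prop :=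
  DifferentiableOn ℂ φ U ∧ MapsTo φ U V ∧
    ∃ χ : ℂ → ℂ, DifferentiableOn ℂ χ V ∧ MapsTo χ V U ∧ InvOn χ φ U V

/-- The algebra `A^∞` of the holomorphic functions on the unit disc whose Taylor coefficients at
the origin form a rapidly decreasing sequence. Its elements are represented by their sequences of
Taylor coefficients; the function on the disc is `AInfty.eval`. -/
def AInfty : Type :=
  {c : ℕ → ℂ // ∀ k : ℕ, BddAbove (range fun n => ‖c n‖ * ((n : ℝ) + 1) ^ k)}

namespace AInfty

/-- Rapidly decreasing sequences as a linear subspace of all sequences. -/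
def sub : Submodule ℂ (ℕ → ℂ) where
  carrier := {c | ∀ k : ℕ, BddAbove (range fun n => ‖c n‖ * ((n : ℝ) + 1) ^ k)}
  zero_mem' := by
    intro k
    refine ⟨0, ?_⟩
    rintro _ ⟨n, rfl⟩
    simp
  add_mem' := by
    intro a b ha hb k
    obtain ⟨A, hA⟩ := ha k
    obtain ⟨B, hB⟩ := hb k
    refine ⟨A + B, ?_⟩
    rintro _ ⟨n, rfl⟩
    have h1 : ‖a n‖ * ((n : ℝ) + 1) ^ k ≤ A := hA ⟨n, rfl⟩
    have h2 : ‖b n‖ * ((n : ℝ) + 1) ^ k ≤ B := hB ⟨n, rfl⟩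
    have h3 : ‖a n + b n‖ * ((n : ℝ) + 1) ^ k ≤ (‖a n‖ + ‖b n‖) * ((n : ℝ) + 1) ^ k := by
      gcongr
      exact norm_add_le _ _
    simp only [Pi.add_apply]
    linarith [add_mul ‖a n‖ ‖b n‖ (((n : ℝ) + 1) ^ k)]
  smul_mem' := by
    intro t a ha k
    obtain ⟨A, hA⟩ := ha k
    refine ⟨‖t‖ * A, ?_⟩
    rintro _ ⟨n, rfl⟩
    have h1 : ‖a n‖ * ((n : ℝ) + 1) ^ k ≤ A := hA ⟨n, rfl⟩
    simp only [Pi.smul_apply, smul_eq_mul, norm_mul, mul_assoc]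
    gcongr

instance : AddCommGroup AInfty := inferInstanceAs (AddCommGroup sub)
instance : Module ℂ AInfty := inferInstanceAs (Module ℂ sub)

/-- The norm `|c|_k = sup_n |c_n| (n + 1) ^ k`. -/
def seminorm (k : ℕ) : Seminorm ℂ AInfty :=
  Seminorm.of (fun c => ⨆ n : ℕ, ‖c.1 n‖ * ((n : ℝ) + 1) ^ k)
    (by
      intro a b
      refine ciSup_le fun n => ?_
      have h1 := le_ciSup (a.2 k) n
      have h2 := le_ciSup (b.2 k) n
      have h3 : ‖a.1 n + b.1 n‖ * ((n : ℝ) + 1) ^ k ≤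
          (‖a.1 n‖ + ‖b.1 n‖) * ((n : ℝ) + 1) ^ k := by
        gcongr
        exact norm_add_le _ _
      change ‖a.1 n + b.1 n‖ * ((n : ℝ) + 1) ^ k ≤ _
      linarith [add_mul ‖a.1 n‖ ‖b.1 n‖ (((n : ℝ) + 1) ^ k)])
    (by
      intro t a
      rw [Real.mul_iSup_of_nonneg (norm_nonneg t)]
      congr 1
      funext n
      change ‖t * a.1 n‖ * ((n : ℝ) + 1) ^ k = _
      rw [norm_mul, mul_assoc])

/-- The Fréchet topology of `A^∞`, generated by the norms `|·|_k`, `k = 0, 1, 2, …`. -/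
instance : TopologicalSpace AInfty :=
  (show SeminormFamily ℂ AInfty ℕ from seminorm).moduleFilterBasis.topology

/-- The holomorphic function `z ↦ ∑ c_n z ^ n` (for `z` in the unit disc). -/
def eval (c : AInfty) (z : ℂ) : ℂ := ∑' n : ℕ, c.1 n * z ^ n

end AInfty

variable {E : Type*} [NormedAddCommGroup E] [NormedSpace ℂ E]

/-- Analytic functions `U → E`. Functions on `U` are represented by their extension by zero
to the whole plane. -/
def IsAnalyticFun (U : Set ℂ) (f : ℂ → E) : Prop :=
  DifferentiableOn ℂ f U ∧ ∀ z, z ∉ U → f z = 0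

/-- A normed space of analytic functions `U → E`: a linear space of analytic functions, together
with a norm on it. -/
structure AnalyticFunctionSpace (U : Set ℂ) (E : Type*) [NormedAddCommGroup E]
    [NormedSpace ℂ E] where
  /-- the underlying linear space of functions -/
  carrier : Submodule ℂ (ℂ → E)
  isAnalyticFun : ∀ f ∈ carrier, IsAnalyticFun U f
  /-- the norm -/
  nrm : Seminorm ℂ carrier
  eq_zero_of_nrm : ∀ f, nrm f = 0 → f = 0

namespace AnalyticFunctionSpace

variable {U : Set ℂ}

/-- The elements of the space, as a type that carries only the norm of the space (and not the
topology of pointwise convergence). -/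
def Elem (F : AnalyticFunctionSpace U E) : Type _ := F.carrier

instance (F : AnalyticFunctionSpace U E) : AddCommGroup F.Elem :=
  inferInstanceAs (AddCommGroup F.carrier)

instance (F : AnalyticFunctionSpace U E) : Module ℂ F.Elem :=
  inferInstanceAs (Module ℂ F.carrier)

instance (F : AnalyticFunctionSpace U E) : Norm F.Elem := ⟨fun f => F.nrm f⟩

theorem core (F : AnalyticFunctionSpace U E) : NormedSpace.Core ℂ F.Elem where
  norm_nonneg f := apply_nonneg F.nrm f
  norm_smul c f := map_smul_eq_mul F.nrm c f
  norm_triangle f g := map_add_le_add F.nrm f g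
  norm_eq_zero_iff f := ⟨F.eq_zero_of_nrm f, fun h => by
    rw [h]
    exact map_zero F.nrm⟩

instance (F : AnalyticFunctionSpace U E) : NormedAddCommGroup F.Elem :=
  NormedAddCommGroup.ofCore F.core

instance (F : AnalyticFunctionSpace U E) : NormedSpace ℂ F.Elem :=
  NormedSpace.ofCore F.core

/-- An element of the space as a function. -/
def Elem.toFun {F : AnalyticFunctionSpace U E} (f : F.Elem) : ℂ → E := f.1

/-- `F` is a module, with jointly continuous pointwise product, over the algebra
`A^∞_U = {a ∘ ψ : a ∈ A^∞}`, where `ψ : U → unitDisc` is a conformal equivalence and the topology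
of `A^∞_U` is that of `A^∞`. Neither the algebra nor its topology depends on the choice of `ψ`,
because composition with an automorphism of the disc is an automorphism of `A^∞`. -/
def IsAInftyModule (F : AnalyticFunctionSpace U E) : Prop :=
  ∃ ψ : ℂ → ℂ, IsConformalEquiv U unitDisc ψ ∧
    ∃ h : ∀ (a : AInfty) (f : F.Elem), (fun z => a.eval (ψ z) • f.toFun z) ∈ F.carrier,
      Continuous fun p : AInfty × F.Elem =>
        (⟨fun z => p.1.eval (ψ z) • p.2.toFun z, h p.1 p.2⟩ : F.Elem)

/-- Acceptable spaces of analytic functions. -/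
structure IsAcceptable (F : AnalyticFunctionSpace U E) : Prop where
  complete : CompleteSpace F.Elem
  continuous_eval : ∀ z ∈ U, Continuous fun f : F.Elem => f.toFun z
  module : F.IsAInftyModule
  conformal : ∀ φ : ℂ → ℂ, IsConformalEquiv U unitDisc φ →
    ∃ K : ℝ, 0 < K ∧ ∀ f : ℂ → E, IsAnalyticFun U f →
      ((fun z => φ z • f z) ∈ F.carrier ↔ f ∈ F.carrier) ∧
      ∀ (hf : f ∈ F.carrier) (hφf : (fun z => φ z • f z) ∈ F.carrier),
        K⁻¹ * F.nrm ⟨fun z => φ z • f z, hφf⟩ ≤ F.nrm ⟨f, hf⟩ ∧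
        F.nrm ⟨f, hf⟩ ≤ K * F.nrm ⟨fun z => φ z • f z, hφf⟩

/-- The space `F_u` of the values at `u` of the functions in `F`. -/
def fiber (F : AnalyticFunctionSpace U E) (u : ℂ) : Set E :=
  {w | ∃ f : F.Elem, f.toFun u = w}

/-- The quotient norm of `F_u`. -/
def fiberNorm (F : AnalyticFunctionSpace U E) (u : ℂ) (w : E) : ℝ :=
  sInf {r | ∃ f : F.Elem, f.toFun u = w ∧ r = ‖f‖}

end AnalyticFunctionSpace

/-- The function `τ_{(n,0]} f : U → E ^ n`, whose `i`-th coordinate, `0 ≤ i < n`, is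
`f^{(i)} / i!` (extended by zero off `U`). -/
def taylorArray (U : Set ℂ) (n : ℕ) (f : ℂ → E) : ℂ → Fin n → E :=
  U.indicator fun z i => ((Nat.factorial i : ℂ))⁻¹ • iteratedDeriv i f z

namespace AnalyticFunctionSpace

variable {U : Set ℂ}

/-- The Rochberg space `F^{(n)}_u` of the arrays of the first `n` Taylor coefficients at `u` of
the functions in `F`. -/
def rochberg (F : AnalyticFunctionSpace U E) (n : ℕ) (u : ℂ) : Set (Fin n → E) :=
  {w | ∃ f : F.Elem, taylorArray U n f.toFun u = w}

/-- The quotient norm of `F^{(n)}_u`. -/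
def rochbergNorm (F : AnalyticFunctionSpace U E) (n : ℕ) (u : ℂ) (w : Fin n → E) : ℝ :=
  sInf {r | ∃ f : F.Elem, taylorArray U n f.toFun u = w ∧ r = ‖f‖}

end AnalyticFunctionSpace

end

/-! Fix the conformal equivalence `ψ` given by the module condition. The Taylor arrays of `F` alone
need not be stable under multiplication by `a ∘ ψ`: at a point `u` the product is the array of `a(ψ
u) • f`, whose scalar moves with `u`. Expand this scalar with centre `ψ z`: it is the sum of the
terms `(ψ z - ψ u)^k` times `(-1)^k a^(k)(ψ z) / k!`, up to a remainder vanishing at `u` to any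
prescribed order. The coefficients lie again in `A^∞`. This suggests taking for the new space all
functions sending `u` to the Taylor array at `u` of `∑ j, (ψ - ψ u)^j • f j`, with `n` functions `f
j` in `F`.

A tuple is recovered from its array: if the entries before `m` vanish, the `m`-th coordinate is
`ψ'(u)^m • f m u`, and `ψ'` has no zeros (`rochbergMap_injective`). Hence the supremum norm of
tuples can be transported, and completeness comes for free. The tuple `(f, 0, …, 0)` gives `τ f`
with the same norm. At a fixed `u`, every array is the Taylor array of one element of `F` that
depends boundedly on the tuple; this yields continuous evaluations and the fibres.

On tuples, multiplication by `a ∘ ψ` is a lower triangular convolution with diagonal `a ∘ ψ`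
(`smul_rochbergArray`, `mulTuple_apply_eq`). Every conformal equivalence onto the disc is such an `a
∘ ψ`, since disc automorphisms are Möbius maps and these belong to `A^∞`. Division by it, with norm
control, therefore passes from `F` to tuples by forward substitution (`exists_rochbergMap_eq`,
`exists_norm_le_mulTuple`). -/

noncomputable section

variable {E : Type*} [NormedAddCommGroup E] [NormedSpace ℂ E]

/-! ### The algebra `A^∞`: evaluation, derivative, geometric series -/

namespace AInfty

theorem withSeminorms :
    WithSeminorms (show SeminormFamily ℂ AInfty ℕ from seminorm) := ⟨rfl⟩

theorem le_seminorm (c : AInfty) (k n : ℕ) : ‖c.1 n‖ * ((n : ℝ) + 1) ^ k ≤ seminorm k c :=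
  le_ciSup (c.2 k) n

theorem summable_inv_sq : Summable fun n : ℕ => ((n : ℝ) + 1)⁻¹ ^ 2 := by
  have := (summable_nat_add_iff 1).2 (Real.summable_nat_pow_inv.2 (by norm_num : 1 < 2))
  simpa using this

/-- The weight of exponent 2 leaves a summable majorant that is uniform on the disc; it serves
convergence, holomorphy and continuity of evaluation alike. -/
theorem norm_term_le (c : AInfty) (n : ℕ) {w : ℂ} (hw : w ∈ unitDisc) :
    ‖c.1 n * w ^ n‖ ≤ seminorm 2 c * ((n : ℝ) + 1)⁻¹ ^ 2 := by
  have hw1 : ‖w‖ ^ n ≤ 1 := pow_le_one₀ (norm_nonneg _) (mem_ball_zero_iff.1 hw).le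
  have h2 : (0 : ℝ) < ((n : ℝ) + 1) ^ 2 := by positivity
  rw [inv_pow, ← div_eq_mul_inv, le_div_iff₀ h2, norm_mul, norm_pow]
  refine le_trans ?_ (le_seminorm c 2 n)
  gcongr
  exact mul_le_of_le_one_right (norm_nonneg _) hw1

theorem hasSum_eval (c : AInfty) {w : ℂ} (hw : w ∈ unitDisc) :
    HasSum (fun n => c.1 n * w ^ n) (c.eval w) :=
  (Summable.of_norm_bounded (summable_inv_sq.mul_left (seminorm 2 c))
    fun n => norm_term_le c n hw).hasSum

theorem differentiableOn_eval (c : AInfty) : DifferentiableOn ℂ c.eval unitDisc :=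
  Complex.differentiableOn_tsum_of_summable_norm (summable_inv_sq.mul_left (seminorm 2 c))
    (fun n => by fun_prop) Metric.isOpen_ball fun n _ hw => norm_term_le c n hw

/-- The termwise derivative. -/
def derivative : AInfty →ₗ[ℂ] AInfty where
  toFun c := ⟨fun n => ((n : ℂ) + 1) * c.1 (n + 1), fun k => by
    refine ⟨seminorm (k + 1) c, ?_⟩
    rintro _ ⟨n, rfl⟩
    refine le_trans ?_ (le_seminorm c (k + 1) (n + 1))
    have h : ‖(n : ℂ) + 1‖ = (n : ℝ) + 1 := by exact_mod_cast Complex.norm_natCast (n + 1)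
    simp only [norm_mul, h]
    rw [mul_comm ((n : ℝ) + 1), mul_assoc, ← pow_succ']
    gcongr
    linarith⟩
  map_add' a b := Subtype.ext (funext fun n => mul_add _ _ _)
  map_smul' t a := Subtype.ext (funext fun n => mul_left_comm _ _ _)

theorem hasDerivAt_eval (c : AInfty) {w : ℂ} (hw : w ∈ unitDisc) :
    HasDerivAt c.eval ((derivative c).eval w) w := by
  have h := Complex.hasSum_deriv_of_summable_norm (F := fun n w => c.1 n * w ^ n)
    (summable_inv_sq.mul_left (seminorm 2 c))
    (fun n => by fun_prop) Metric.isOpen_ball (fun n _ hw => norm_term_le c n hw) hw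
  have h1 := (hasSum_nat_add_iff' 1).2 h
  have h2 : (derivative c).eval w = deriv c.eval w := by
    refine (hasSum_eval (derivative c) hw).unique ?_
    have h3 : deriv c.eval w = deriv (fun w => ∑' i : ℕ, c.1 i * w ^ i) w -
        ∑ i ∈ Finset.range 1, deriv (fun w => c.1 i * w ^ i) w := by
      simp only [Finset.sum_range_one, pow_zero, deriv_const, sub_zero]
      rfl
    rw [h3]
    have h4 : ∀ n, (derivative c).1 n * w ^ n = deriv (fun w => c.1 (n + 1) * w ^ (n + 1)) w := by
      intro n
      rw [deriv_const_mul_field, deriv_pow_field, Nat.add_sub_cancel, Nat.cast_succ]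
      change (((n : ℂ) + 1) * c.1 (n + 1)) * w ^ n = _
      ring
    simpa only [h4] using h1
  rw [h2]
  exact (c.differentiableOn_eval.differentiableAt (Metric.isOpen_ball.mem_nhds hw)).hasDerivAt

theorem eval_add (a b : AInfty) {w : ℂ} (hw : w ∈ unitDisc) :
    (a + b).eval w = a.eval w + b.eval w := by
  refine (hasSum_eval (a + b) hw).unique ?_
  have h : ∀ n, (a + b).1 n * w ^ n = a.1 n * w ^ n + b.1 n * w ^ n :=
    fun n => add_mul (a.1 n) (b.1 n) (w ^ n)
  simpa only [h] using (hasSum_eval a hw).add (hasSum_eval b hw)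

theorem eval_smul (t : ℂ) (a : AInfty) {w : ℂ} (hw : w ∈ unitDisc) :
    (t • a).eval w = t * a.eval w := by
  refine (hasSum_eval (t • a) hw).unique ?_
  have h : ∀ n, (t • a).1 n * w ^ n = t * (a.1 n * w ^ n) := fun n => mul_assoc t (a.1 n) (w ^ n)
  simpa only [h] using (hasSum_eval a hw).mul_left t

theorem norm_eval_le (c : AInfty) {w : ℂ} (hw : w ∈ unitDisc) :
    ‖c.eval w‖ ≤ (∑' n : ℕ, ((n : ℝ) + 1)⁻¹ ^ 2) * seminorm 2 c := by
  rw [mul_comm, ← tsum_mul_left]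
  exact tsum_of_norm_bounded (summable_inv_sq.mul_left (seminorm 2 c)).hasSum
    fun n => norm_term_le c n hw

theorem continuous_eval {w : ℂ} (hw : w ∈ unitDisc) : Continuous fun c : AInfty => c.eval w := by
  let L : AInfty →ₗ[ℂ] ℂ :=
    { toFun := fun c => c.eval w
      map_add' := fun a b => eval_add a b hw
      map_smul' := fun t a => eval_smul t a hw }
  have hC : 0 ≤ ∑' n : ℕ, ((n : ℝ) + 1)⁻¹ ^ 2 := tsum_nonneg fun n => by positivity
  refine WithSeminorms.continuous_normedSpace_rng ℂ withSeminorms L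
    ⟨{2}, ⟨∑' n : ℕ, ((n : ℝ) + 1)⁻¹ ^ 2, hC⟩, fun c => ?_⟩
  rw [Finset.sup_singleton]
  exact norm_eval_le c hw

/-- The coordinate function of the disc. -/
def coord : AInfty := ⟨Pi.single 1 1, fun k => by
  refine ⟨2 ^ k, ?_⟩
  rintro _ ⟨n, rfl⟩
  rcases eq_or_ne n 1 with rfl | hn
  · norm_num
  · simp [hn]⟩

theorem eval_coord (w : ℂ) : coord.eval w = w := by
  rw [eval, tsum_eq_single 1 fun n hn => by simp [coord, hn]]
  simp [coord]

/-- The geometric series with ratio `q`. -/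
def geom (q : ℂ) (hq : ‖q‖ < 1) : AInfty := ⟨fun n => q ^ n, fun k => by
  have h := summable_pow_mul_geometric_of_norm_lt_one (R := ℝ) k (r := ‖q‖) (by simpa using hq)
  have h1 := ((summable_nat_add_iff 1).2 h).tendsto_atTop_zero.bddAbove_range
  obtain ⟨B, hB⟩ := h1
  -- The bound `B` controls `(n + 1)^k ‖q‖^(n + 1)`, so one factor `‖q‖` has to be divided out.
  rcases eq_or_ne q 0 with rfl | h0
  · refine ⟨1, ?_⟩
    rintro _ ⟨n, rfl⟩
    rcases n with _ | n <;> simp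
  · refine ⟨B * ‖q‖⁻¹, ?_⟩
    rintro _ ⟨n, rfl⟩
    have h2 := hB ⟨n, rfl⟩
    have h3 : 0 < ‖q‖ := norm_pos_iff.2 h0
    simp only
    rw [← div_eq_mul_inv, le_div_iff₀ h3, norm_pow]
    refine le_of_eq_of_le ?_ h2
    push_cast
    ring⟩

theorem eval_geom (q : ℂ) (hq : ‖q‖ < 1) {w : ℂ} (hw : w ∈ unitDisc) :
    (geom q hq).eval w = (1 - q * w)⁻¹ := by
  have hw := mem_ball_zero_iff.1 hw
  have : ‖q * w‖ < 1 := by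
    rw [norm_mul]
    nlinarith [norm_nonneg q, norm_nonneg w]
  rw [← tsum_geometric_of_norm_lt_one this]
  simp [eval, geom, mul_pow]

end AInfty

/-! ### Automorphisms of the disc and conformal equivalences -/

/-- The Möbius transformation of the disc exchanging `0` and `α`. -/
def mobius (α w : ℂ) : ℂ := (α - w) / (1 - (starRingEnd ℂ) α * w)

theorem one_sub_conj_mul_ne_zero {α w : ℂ} (hα : α ∈ unitDisc) (hw : w ∈ unitDisc) :
    1 - (starRingEnd ℂ) α * w ≠ 0 := by
  have hα := mem_ball_zero_iff.1 hα
  have hw := mem_ball_zero_iff.1 hw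
  intro h
  have h1 : ‖(starRingEnd ℂ) α * w‖ = 1 := by
    rw [← sub_eq_zero.1 h, norm_one]
  rw [norm_mul, RCLike.norm_conj] at h1
  nlinarith [norm_nonneg α, norm_nonneg w]

theorem mapsTo_mobius {α : ℂ} (hα : α ∈ unitDisc) : MapsTo (mobius α) unitDisc unitDisc := by
  intro w hw
  have h0 := norm_pos_iff.2 (one_sub_conj_mul_ne_zero hα hw)
  have hα := mem_ball_zero_iff.1 hα
  have hw := mem_ball_zero_iff.1 hw
  refine mem_ball_zero_iff.2 ?_
  rw [mobius, norm_div, div_lt_one h0]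
  refine lt_of_pow_lt_pow_left₀ 2 h0.le ?_
  have hα2 : ‖α‖ ^ 2 < 1 := by nlinarith [norm_nonneg α]
  have hw2 : ‖w‖ ^ 2 < 1 := by nlinarith [norm_nonneg w]
  rw [← Complex.normSq_eq_norm_sq, Complex.normSq_apply] at hα2 hw2
  rw [← Complex.normSq_eq_norm_sq, ← Complex.normSq_eq_norm_sq, Complex.normSq_apply,
    Complex.normSq_apply]
  simp only [Complex.sub_re, Complex.sub_im, Complex.mul_re, Complex.mul_im, Complex.conj_re,
    Complex.conj_im, Complex.one_re, Complex.one_im]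
  nlinarith [mul_pos (sub_pos.2 hα2) (sub_pos.2 hw2)]

theorem mobius_mobius {α w : ℂ} (hα : α ∈ unitDisc) (hw : w ∈ unitDisc) :
    mobius α (mobius α w) = w := by
  have h0 := one_sub_conj_mul_ne_zero hα hw
  have h1 := one_sub_conj_mul_ne_zero hα (mapsTo_mobius hα hw)
  have h2 : mobius α w * (1 - (starRingEnd ℂ) α * w) = α - w := div_mul_cancel₀ _ h0
  rw [mobius, div_eq_iff h1]
  linear_combination -h2

theorem differentiableOn_mobius {α : ℂ} (hα : α ∈ unitDisc) :
    DifferentiableOn ℂ (mobius α) unitDisc := by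
  unfold mobius
  refine DifferentiableOn.div (by fun_prop) (by fun_prop) fun w hw =>
    one_sub_conj_mul_ne_zero hα hw

/-- The conformal automorphisms of the disc are Möbius transformations. -/
theorem IsConformalEquiv.exists_eq_mul_mobius {b : ℂ → ℂ}
    (hb : IsConformalEquiv unitDisc unitDisc b) :
    ∃ α ∈ unitDisc, ∃ l : ℂ, ∀ w ∈ unitDisc, b w = l * mobius α w := by
  obtain ⟨hbd, hbm, χ, hχd, hχm, hinv⟩ := hb
  have h0 : (0 : ℂ) ∈ unitDisc := Metric.mem_ball_self one_pos
  set α := χ 0 with hαdef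
  have hα : α ∈ unitDisc := hχm h0
  have hm0 : mobius α 0 = α := by simp [mobius]
  have hmα : mobius α α = 0 := by simp [mobius]
  set c : ℂ → ℂ := b ∘ mobius α
  set d : ℂ → ℂ := mobius α ∘ χ
  have hcd : DifferentiableOn ℂ c unitDisc :=
    hbd.comp (differentiableOn_mobius hα) (mapsTo_mobius hα)
  have hdd : DifferentiableOn ℂ d unitDisc := (differentiableOn_mobius hα).comp hχd hχm
  have hcm : MapsTo c unitDisc unitDisc := hbm.comp (mapsTo_mobius hα)
  have hdm : MapsTo d unitDisc unitDisc := (mapsTo_mobius hα).comp hχm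
  have hc0 : c 0 = 0 := by simpa [c, hm0] using hinv.2 h0
  have hd0 : d 0 = 0 := by simp [d, ← hαdef, hmα]
  have hdc : ∀ w ∈ unitDisc, d (c w) = w := fun w hw => by
    simp only [c, d, Function.comp]
    rw [hinv.1 (mapsTo_mobius hα hw), mobius_mobius hα hw]
  -- The Schwarz lemma for `c` and for its inverse `d`, both fixing the origin. Equality at the
  -- single point `1 / 2` then forces `c` to be linear.
  have hnorm : ∀ w ∈ unitDisc, ‖c w‖ = ‖w‖ := fun w hw => by
    refine le_antisymm ?_ ?_
    · exact Complex.norm_le_norm_of_mapsTo_ball hcd (hcm.mono_right Metric.ball_subset_closedBall)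
        hc0 (mem_ball_zero_iff.1 hw)
    · have := Complex.norm_le_norm_of_mapsTo_ball hdd
        (hdm.mono_right Metric.ball_subset_closedBall) hd0 (mem_ball_zero_iff.1 (hcm hw))
      rwa [hdc w hw] at this
  have hhalf : (1 / 2 : ℂ) ∈ unitDisc := mem_ball_zero_iff.2 (by norm_num)
  have hslope : ‖dslope c 0 (1 / 2)‖ = 1 / 1 := by
    rw [dslope_of_ne _ (by norm_num), slope_def_field, hc0, sub_zero, sub_zero, norm_div,
      hnorm _ hhalf]
    norm_num
  obtain ⟨l, -, hl⟩ := Complex.affine_of_mapsTo_ball_of_exists_norm_dslope_eq_div' (f := c) (c := 0)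
    (R₁ := 1) (R₂ := 1) hcd (by rw [hc0]; exact hcm.mono_right Metric.ball_subset_closedBall)
    ⟨_, hhalf, hslope⟩
  refine ⟨α, hα, l, fun w hw => ?_⟩
  have h1 := hl (mapsTo_mobius hα hw)
  simp only [c, Function.comp, mobius_mobius hα hw] at h1
  rw [h1, hm0, hinv.2 h0]
  simp [mul_comm]

theorem exists_eval_eq_mobius {α : ℂ} (hα : α ∈ unitDisc) :
    ∃ a : AInfty, ∀ w ∈ unitDisc, a.eval w = mobius α w := by
  rcases eq_or_ne α 0 with rfl | h0
  · refine ⟨(-1 : ℂ) • AInfty.coord, fun w hw => ?_⟩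
    rw [AInfty.eval_smul _ _ hw, AInfty.eval_coord]
    simp [mobius]
  · have hc : (starRingEnd ℂ) α ≠ 0 := by simpa using h0
    have hn : ‖(starRingEnd ℂ) α‖ < 1 := by
      rw [RCLike.norm_conj]
      exact mem_ball_zero_iff.1 hα
    -- Partial fractions; the geometric series of ratio `0` is the constant 1.
    refine ⟨((starRingEnd ℂ) α)⁻¹ • AInfty.geom 0 (by simp) +
      (α - ((starRingEnd ℂ) α)⁻¹) • AInfty.geom _ hn, fun w hw => ?_⟩
    have h1 := one_sub_conj_mul_ne_zero hα hw
    rw [AInfty.eval_add _ _ hw, AInfty.eval_smul _ _ hw, AInfty.eval_smul _ _ hw,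
      AInfty.eval_geom _ _ hw, AInfty.eval_geom _ _ hw, mobius]
    field_simp
    ring

/-- Any two conformal equivalences onto the disc differ by an element of `A^∞`. -/
theorem IsConformalEquiv.exists_eval_comp {U : Set ℂ} {φ ψ : ℂ → ℂ}
    (hφ : IsConformalEquiv U unitDisc φ) (hψ : IsConformalEquiv U unitDisc ψ) :
    ∃ a : AInfty, ∀ z ∈ U, a.eval (ψ z) = φ z := by
  obtain ⟨hφd, hφm, χφ, hχφd, hχφm, hφi⟩ := hφ
  obtain ⟨hψd, hψm, χψ, hχψd, hχψm, hψi⟩ := hψ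
  have hb : IsConformalEquiv unitDisc unitDisc (φ ∘ χψ) :=
    ⟨hφd.comp hχψd hχψm, hφm.comp hχψm, ψ ∘ χφ, hψd.comp hχφd hχφm, hψm.comp hχφm,
      fun w hw => by simp [hφi.1 (hχψm hw), hψi.2 hw],
      fun w hw => by simp [hψi.1 (hχφm hw), hφi.2 hw]⟩
  obtain ⟨α, hα, l, h⟩ := hb.exists_eq_mul_mobius
  obtain ⟨a, ha⟩ := exists_eval_eq_mobius hα
  refine ⟨l • a, fun z hz => ?_⟩
  rw [AInfty.eval_smul _ _ (hψm hz), ha _ (hψm hz), ← h _ (hψm hz)]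
  simp [hψi.1 hz]

/-- Chain rule applied to `χ ∘ φ = id`. -/
theorem IsConformalEquiv.deriv_ne_zero {U V : Set ℂ} {φ : ℂ → ℂ} (hU : IsOpen U) (hV : IsOpen V)
    (h : IsConformalEquiv U V φ) {z : ℂ} (hz : z ∈ U) : deriv φ z ≠ 0 := by
  obtain ⟨hd, hm, χ, hχd, -, hi⟩ := h
  have h1 := (hd.differentiableAt (hU.mem_nhds hz)).hasDerivAt
  have h2 := (hχd.differentiableAt (hV.mem_nhds (hm hz))).hasDerivAt
  have h3 := h2.comp z h1
  have h4 : HasDerivAt (χ ∘ φ) 1 z :=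
    (hasDerivAt_id z).congr_of_eventuallyEq
      (eventually_of_mem (hU.mem_nhds hz) fun w hw => hi.1 hw)
  intro h0
  have := h3.unique h4
  simp [h0] at this

/-! ### Orders of vanishing and leading coefficients of powers of `ψ - ψ u` -/

theorem AnalyticAt.dslope_self {ψ : ℂ → ℂ} {u : ℂ} (hψ : AnalyticAt ℂ ψ u) :
    AnalyticAt ℂ (dslope ψ u) u := by
  obtain ⟨p, hp⟩ := hψ
  exact ⟨_, hp.has_fpower_series_dslope_fslope⟩

theorem sub_pow_smul_eq (ψ : ℂ → ℂ) (g : ℂ → E) (u : ℂ) (m : ℕ) (z : ℂ) :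
    (ψ z - ψ u) ^ m • g z = (z - u) ^ m • (dslope ψ u z ^ m • g z) := by
  rw [← sub_smul_dslope, smul_smul, smul_eq_mul, mul_pow]

theorem le_analyticOrderAt_sub_pow_smul {ψ : ℂ → ℂ} {g : ℂ → E} {u : ℂ} (hψ : AnalyticAt ℂ ψ u)
    (hg : AnalyticAt ℂ g u) (m : ℕ) :
    (m : ℕ∞) ≤ analyticOrderAt (fun z => (ψ z - ψ u) ^ m • g z) u := by
  have hd := hψ.dslope_self
  rw [natCast_le_analyticOrderAt (by fun_prop)]
  exact ⟨fun z => dslope ψ u z ^ m • g z, by fun_prop,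
    Eventually.of_forall fun z => sub_pow_smul_eq ψ g u m z⟩

theorem iteratedDeriv_eq_zero_of_lt_order [CompleteSpace E] {f : ℂ → E} {u : ℂ} {n i : ℕ}
    (hf : AnalyticAt ℂ f u) (h : (n : ℕ∞) ≤ analyticOrderAt f u) (hi : i < n) :
    iteratedDeriv i f u = 0 :=
  (natCast_le_analyticOrderAt_iff_iteratedDeriv_eq_zero hf).1 h i hi

/-- The leading Taylor coefficient of `(ψ - ψ u) ^ m • g` at `u`. -/
theorem iteratedDeriv_sub_pow_smul [CompleteSpace E] {ψ : ℂ → ℂ} {g : ℂ → E} {u : ℂ}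
    (hψ : AnalyticAt ℂ ψ u) (hg : AnalyticAt ℂ g u) (m : ℕ) :
    ((m.factorial : ℂ))⁻¹ • iteratedDeriv m (fun z => (ψ z - ψ u) ^ m • g z) u =
      deriv ψ u ^ m • g u := by
  have hd := hψ.dslope_self
  set k : ℂ → E := fun z => dslope ψ u z ^ m • g z with hk
  have hka : AnalyticAt ℂ k u := by fun_prop
  -- Freezing the cofactor `k` at `u` costs a term of order at least `m + 1`, which the `m`-th
  -- derivative does not see.
  have hsplit : (fun z => (ψ z - ψ u) ^ m • g z) =
      (fun z => (z - u) ^ m • k u) + fun z => (z - u) ^ m • (k z - k u) := by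
    funext z
    rw [Pi.add_apply, ← smul_add, add_sub_cancel, sub_pow_smul_eq]
  have h1 : ((m + 1 : ℕ) : ℕ∞) ≤ analyticOrderAt (fun z => (z - u) ^ m • (k z - k u)) u := by
    have h2 : AnalyticAt ℂ (fun z => (z - u) ^ m) u := by fun_prop
    have h3 : AnalyticAt ℂ (fun z => k z - k u) u := by fun_prop
    have h4 := analyticOrderAt_smul h2 h3
    have h5 : (m : ℕ∞) ≤ analyticOrderAt (fun z => (z - u) ^ m) u := by
      simpa using le_analyticOrderAt_sub_pow_smul (ψ := id) (g := fun _ => (1 : ℂ))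
        analyticAt_id analyticAt_const m
    have h6 : (1 : ℕ∞) ≤ analyticOrderAt (fun z => k z - k u) u := by
      rw [Order.one_le_iff_ne_zero, h3.analyticOrderAt_ne_zero, sub_self]
    have h7 := add_le_add h5 h6
    rw [← h4] at h7
    exact_mod_cast h7
  rw [hsplit, iteratedDeriv_add (AnalyticAt.contDiffAt (by fun_prop))
    (AnalyticAt.contDiffAt (by fun_prop)),
    iteratedDeriv_eq_zero_of_lt_order (by fun_prop) h1 (Nat.lt_succ_self m), add_zero,
    iteratedDeriv_smul_const (AnalyticAt.contDiffAt (by fun_prop))]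
  have h8 : iteratedDeriv m (fun z => (z - u) ^ m) u = (m.factorial : ℂ) := by
    have h9 := congrFun (iteratedDeriv_comp_sub_const m (fun z : ℂ => z ^ m) u) u
    rw [h9]
    simp [Nat.descFactorial_self]
  rw [h8, inv_smul_smul₀ (by exact_mod_cast m.factorial_ne_zero), hk]
  simp

/-! ### Taylor expansion of a constant with moving centre -/

namespace AInfty

/-- The coefficient `(-1) ^ k a ^ (k) / k!` of the expansion of the constant `a(w₀)` in powers of
`w - w₀`. -/
def reversedTaylor : ℕ → AInfty →ₗ[ℂ] AInfty
  | 0 => LinearMap.id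
  | k + 1 => (-((k : ℂ) + 1)⁻¹) • derivative ∘ₗ reversedTaylor k

theorem hasDerivAt_eval_reversedTaylor (a : AInfty) (k : ℕ) {w : ℂ} (hw : w ∈ unitDisc) :
    HasDerivAt (reversedTaylor k a).eval
      (-((k : ℂ) + 1) * (reversedTaylor (k + 1) a).eval w) w := by
  have h := hasDerivAt_eval (reversedTaylor k a) hw
  convert h using 1
  have h0 : (k : ℂ) + 1 ≠ 0 := by exact_mod_cast k.succ_ne_zero
  change _ * ((-((k : ℂ) + 1)⁻¹) • derivative (reversedTaylor k a)).eval w = _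
  rw [eval_smul _ _ hw]
  field_simp

/-- The Taylor remainder of `a(w₀)`, as a function of the centre. -/
def remainder (a : AInfty) (w₀ : ℂ) (m : ℕ) (w : ℂ) : ℂ :=
  a.eval w₀ - ∑ k ∈ Finset.range m, (w - w₀) ^ k * (reversedTaylor k a).eval w

/-- Differentiation in the centre telescopes: the derivative of each power cancels against the
derivative of the preceding coefficient, and only the last coefficient contributes. -/
theorem hasDerivAt_remainder (a : AInfty) (w₀ : ℂ) (m : ℕ) {w : ℂ} (hw : w ∈ unitDisc) :
    HasDerivAt (remainder a w₀ (m + 1))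
      ((w - w₀) ^ m * (((m : ℂ) + 1) * (reversedTaylor (m + 1) a).eval w)) w := by
  induction m with
  | zero =>
    have h := (hasDerivAt_eval_reversedTaylor a 0 hw).const_sub (a.eval w₀)
    convert! h using 1
    · funext w
      simp [remainder]
    · simp
  | succ m ih =>
    have h1 : HasDerivAt (fun w => (w - w₀) ^ (m + 1)) (((m : ℂ) + 1) * (w - w₀) ^ m) w := by
      simpa using ((hasDerivAt_id w).sub_const w₀).fun_pow (m + 1)
    have h := ih.sub (h1.mul (hasDerivAt_eval_reversedTaylor a (m + 1) hw))
    convert! h using 1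
    · funext w
      simp only [remainder, Finset.sum_range_succ _ (m + 1), Pi.sub_apply, Pi.mul_apply]
      ring
    · push_cast
      ring

theorem remainder_self (a : AInfty) (w₀ : ℂ) (m : ℕ) : remainder a w₀ (m + 1) w₀ = 0 := by
  simp [remainder, Finset.sum_range_succ', reversedTaylor]

theorem analyticAt_eval_comp (a : AInfty) {U : Set ℂ} {ψ : ℂ → ℂ} (hU : IsOpen U)
    (hψ : DifferentiableOn ℂ ψ U) (hm : MapsTo ψ U unitDisc) {u : ℂ} (hu : u ∈ U) :
    AnalyticAt ℂ (fun z => a.eval (ψ z)) u :=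
  (a.differentiableOn_eval.comp hψ hm).analyticAt (hU.mem_nhds hu)

theorem analyticAt_remainder_comp (a : AInfty) {U : Set ℂ} {ψ : ℂ → ℂ} (hU : IsOpen U)
    (hψ : DifferentiableOn ℂ ψ U) (hm : MapsTo ψ U unitDisc) {u : ℂ} (hu : u ∈ U)
    (w₀ : ℂ) (m : ℕ) : AnalyticAt ℂ (fun z => remainder a w₀ m (ψ z)) u := by
  have h1 := fun k => analyticAt_eval_comp (reversedTaylor k a) hU hψ hm hu
  have h2 := hψ.analyticAt (hU.mem_nhds hu)
  unfold remainder
  refine analyticAt_const.sub (Finset.analyticAt_fun_sum _ fun k _ => ?_)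
  exact ((h2.sub analyticAt_const).pow k).mul (h1 k)

/-- The remainder vanishes at `u` and its derivative carries the factor `(ψ - ψ u)^(m - 1)` when `m`
is positive, so integration gains one order. -/
theorem le_analyticOrderAt_remainder_comp (a : AInfty) {U : Set ℂ} {ψ : ℂ → ℂ} (hU : IsOpen U)
    (hψ : DifferentiableOn ℂ ψ U) (hm : MapsTo ψ U unitDisc) {u : ℂ} (hu : u ∈ U) (m : ℕ) :
    (m : ℕ∞) ≤ analyticOrderAt (fun z => remainder a (ψ u) m (ψ z)) u := by
  rcases m with _ | m
  · simp
  have h1 := analyticAt_remainder_comp a hU hψ hm hu (ψ u) (m + 1)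
  rw [Nat.cast_succ, ← analyticOrderAt_deriv_ge_iff h1 (remainder_self a (ψ u) m)]
  have h2 := hψ.analyticAt (hU.mem_nhds hu)
  have h3 := analyticAt_eval_comp (reversedTaylor (m + 1) a) hU hψ hm hu
  have h4 : AnalyticAt ℂ (fun z =>
      (((m : ℂ) + 1) * (reversedTaylor (m + 1) a).eval (ψ z)) * deriv ψ z) u :=
    (analyticAt_const.mul h3).mul h2.deriv
  refine (le_analyticOrderAt_sub_pow_smul h2 h4 m).trans_eq ?_
  refine analyticOrderAt_congr (eventually_of_mem (hU.mem_nhds hu) fun z hz => ?_)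
  have h5 := (hasDerivAt_remainder a (ψ u) m (hm hz)).comp z
    (hψ.differentiableAt (hU.mem_nhds hz)).hasDerivAt
  simp only [smul_eq_mul]
  rw [← mul_assoc]
  exact h5.deriv.symm

end AInfty

theorem IsAnalyticFun.analyticAt [CompleteSpace E] {U : Set ℂ} (hU : IsOpen U) {f : ℂ → E}
    (hf : IsAnalyticFun U f) {u : ℂ} (hu : u ∈ U) : AnalyticAt ℂ f u :=
  hf.1.analyticAt (hU.mem_nhds hu)

/-! ### Taylor arrays -/

section taylorArray

variable {U : Set ℂ} {n : ℕ} {u : ℂ} {f g : ℂ → E}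

theorem taylorArray_apply (hu : u ∈ U) (f : ℂ → E) (i : Fin n) :
    taylorArray U n f u i = ((Nat.factorial i : ℂ))⁻¹ • iteratedDeriv i f u := by
  rw [taylorArray, indicator_of_mem hu]

theorem taylorArray_of_notMem (hu : u ∉ U) (f : ℂ → E) : taylorArray U n f u = 0 :=
  indicator_of_notMem hu _

theorem taylorArray_add [CompleteSpace E] (hf : AnalyticAt ℂ f u) (hg : AnalyticAt ℂ g u) :
    taylorArray U n (f + g) u = taylorArray U n f u + taylorArray U n g u := by
  by_cases hu : u ∈ U
  · funext i
    rw [Pi.add_apply, taylorArray_apply hu, taylorArray_apply hu, taylorArray_apply hu,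
      iteratedDeriv_add hf.contDiffAt hg.contDiffAt, smul_add]
  · simp [taylorArray_of_notMem hu]

theorem taylorArray_smul (c : ℂ) :
    taylorArray U n (c • f) u = c • taylorArray U n f u := by
  by_cases hu : u ∈ U
  · funext i
    rw [Pi.smul_apply, taylorArray_apply hu, taylorArray_apply hu, iteratedDeriv_const_smul_field,
      smul_comm]
  · simp [taylorArray_of_notMem hu]

theorem taylorArray_sum [CompleteSpace E] {ι : Type*} (s : Finset ι) {F : ι → ℂ → E}
    (hF : ∀ i ∈ s, AnalyticAt ℂ (F i) u) :
    taylorArray U n (fun z => ∑ i ∈ s, F i z) u = ∑ i ∈ s, taylorArray U n (F i) u := by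
  by_cases hu : u ∈ U
  · funext i
    rw [Finset.sum_apply, taylorArray_apply hu,
      iteratedDeriv_fun_sum fun j hj => (hF j hj).contDiffAt, Finset.smul_sum]
    simp only [taylorArray_apply hu]
  · simp [taylorArray_of_notMem hu]

theorem taylorArray_eq_zero_of_le_order [CompleteSpace E] (hf : AnalyticAt ℂ f u)
    (h : (n : ℕ∞) ≤ analyticOrderAt f u) : taylorArray U n f u = 0 := by
  by_cases hu : u ∈ U
  · funext i
    rw [taylorArray_apply hu, iteratedDeriv_eq_zero_of_lt_order hf h i.2, smul_zero, Pi.zero_apply]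
  · exact taylorArray_of_notMem hu f

theorem isAnalyticFun_taylorArray [CompleteSpace E] (hU : IsOpen U) (hf : IsAnalyticFun U f) :
    IsAnalyticFun U (taylorArray U n f) := by
  refine ⟨differentiableOn_pi.2 fun i => ?_, fun z hz => taylorArray_of_notMem hz f⟩
  have h : DifferentiableOn ℂ (fun z => ((Nat.factorial i : ℂ))⁻¹ • iteratedDeriv i f z) U :=
    fun z hz => by
      have h1 : AnalyticAt ℂ (iteratedDeriv i f) z := by
        rw [iteratedDeriv_eq_iterate]
        exact (hf.analyticAt hU hz).iterated_deriv i
      exact (h1.differentiableAt.const_smul _).differentiableWithinAt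
  exact h.congr fun z hz => taylorArray_apply hz f i

end taylorArray

/-! ### Arrays generated by tuples of functions -/

/-- The function `∑ j, (ψ - ψ u) ^ j • f j`. -/
def rochbergSum (ψ : ℂ → ℂ) {n : ℕ} (f : Fin n → ℂ → E) (u z : ℂ) : E :=
  ∑ j : Fin n, (ψ z - ψ u) ^ (j : ℕ) • f j z

/-- The function whose value at `u` is the array of the first `n` Taylor coefficients at `u` of
`∑ j, (ψ - ψ u) ^ j • f j`. -/
def rochbergArray (U : Set ℂ) (ψ : ℂ → ℂ) {n : ℕ} (f : Fin n → ℂ → E) (u : ℂ) : Fin n → E :=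
  taylorArray U n (rochbergSum ψ f u) u

section rochbergArray

variable {U : Set ℂ} {ψ : ℂ → ℂ} {n : ℕ} {f g : Fin n → ℂ → E} {u : ℂ}

theorem analyticAt_rochbergSum (hψ : AnalyticAt ℂ ψ u) (hf : ∀ j, AnalyticAt ℂ (f j) u) (v : ℂ) :
    AnalyticAt ℂ (rochbergSum ψ f v) u :=
  Finset.analyticAt_fun_sum _ fun j _ => ((hψ.sub analyticAt_const).pow j).smul (hf j)

theorem rochbergArray_of_notMem (hu : u ∉ U) (f : Fin n → ℂ → E) : rochbergArray U ψ f u = 0 :=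
  taylorArray_of_notMem hu _

theorem rochbergArray_add [CompleteSpace E] (hU : IsOpen U) (hψ : DifferentiableOn ℂ ψ U)
    (hf : ∀ j, IsAnalyticFun U (f j)) (hg : ∀ j, IsAnalyticFun U (g j)) :
    rochbergArray U ψ (f + g) = rochbergArray U ψ f + rochbergArray U ψ g := by
  funext u
  by_cases hu : u ∈ U
  · have hψu := hψ.analyticAt (hU.mem_nhds hu)
    have h : rochbergSum ψ (f + g) u = rochbergSum ψ f u + rochbergSum ψ g u := by
      funext z
      simp [rochbergSum, Finset.sum_add_distrib]
    rw [rochbergArray, h, taylorArray_add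
      (analyticAt_rochbergSum hψu (fun j => (hf j).analyticAt hU hu) u)
      (analyticAt_rochbergSum hψu (fun j => (hg j).analyticAt hU hu) u)]
    rfl
  · simp [rochbergArray_of_notMem hu]

theorem rochbergArray_smul (c : ℂ) (f : Fin n → ℂ → E) :
    rochbergArray U ψ (c • f) = c • rochbergArray U ψ f := by
  funext u
  have h : rochbergSum ψ (c • f) u = c • rochbergSum ψ f u := by
    funext z
    simp [rochbergSum, Finset.smul_sum, smul_comm c]
  rw [rochbergArray, h, taylorArray_smul]
  rfl

/-- The differentiated function itself depends on `u`. The binomial formula separates the variables: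
powers of `ψ u` come out as scalars, leaving Taylor arrays of the fixed functions `ψ^k • f j`. -/
theorem isAnalyticFun_rochbergArray [CompleteSpace E] (hU : IsOpen U)
    (hψ : DifferentiableOn ℂ ψ U) (hf : ∀ j, IsAnalyticFun U (f j)) :
    IsAnalyticFun U (rochbergArray U ψ f) := by
  refine ⟨?_, fun z hz => rochbergArray_of_notMem hz f⟩
  have han : ∀ (j : Fin n) (k : ℕ), IsAnalyticFun U fun z => ψ z ^ k • f j z := fun j k =>
    ⟨(hψ.pow k).smul (hf j).1, fun z hz => by simp [(hf j).2 z hz]⟩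
  have h : DifferentiableOn ℂ (fun u => ∑ j : Fin n, ∑ k ∈ Finset.range (j + 1),
      ((-ψ u) ^ ((j : ℕ) - k) * ((j : ℕ).choose k : ℂ)) •
        taylorArray U n (fun z => ψ z ^ k • f j z) u) U :=
    DifferentiableOn.fun_sum fun j _ => DifferentiableOn.fun_sum fun k _ =>
      ((hψ.neg.pow _).mul_const _).smul (isAnalyticFun_taylorArray hU (han j k)).1
  refine h.congr fun u hu => ?_
  have h1 : rochbergSum ψ f u = fun z => ∑ j : Fin n, ∑ k ∈ Finset.range (j + 1),
      (((-ψ u) ^ ((j : ℕ) - k) * ((j : ℕ).choose k : ℂ)) • fun z => ψ z ^ k • f j z) z := by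
    funext z
    refine Finset.sum_congr rfl fun j _ => ?_
    rw [sub_eq_add_neg, add_pow, Finset.sum_smul]
    refine Finset.sum_congr rfl fun k _ => ?_
    rw [Pi.smul_apply, smul_smul]
    ring_nf
  have h2 : ∀ (j : Fin n) (k : ℕ), AnalyticAt ℂ
      (((-ψ u) ^ ((j : ℕ) - k) * ((j : ℕ).choose k : ℂ)) • fun z => ψ z ^ k • f j z) u :=
    fun j k => ((han j k).analyticAt hU hu).const_smul
  rw [rochbergArray, h1, taylorArray_sum _ fun j _ => Finset.analyticAt_fun_sum _ fun k _ => h2 j k]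
  refine Finset.sum_congr rfl fun j _ => ?_
  rw [taylorArray_sum _ fun k _ => h2 j k]
  exact Finset.sum_congr rfl fun k _ => taylorArray_smul _

/-- If the first `m` functions vanish, then the `m`-th coordinate of the array only depends on the
`m`-th function. -/
theorem rochbergArray_apply_of_forall_lt [CompleteSpace E] (hU : IsOpen U)
    (hψ : DifferentiableOn ℂ ψ U) (hf : ∀ j, IsAnalyticFun U (f j)) (m : Fin n)
    (h0 : ∀ j < m, f j = 0) (hu : u ∈ U) :
    rochbergArray U ψ f u m = deriv ψ u ^ (m : ℕ) • f m u := by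
  have hψu := hψ.analyticAt (hU.mem_nhds hu)
  have hfu := fun j => (hf j).analyticAt hU hu
  have han : ∀ j : Fin n, AnalyticAt ℂ (fun z => (ψ z - ψ u) ^ (j : ℕ) • f j z) u := fun j =>
    ((hψu.sub analyticAt_const).pow j).smul (hfu j)
  rw [rochbergArray, taylorArray_apply hu]
  unfold rochbergSum
  rw [iteratedDeriv_fun_sum fun j _ => (han j).contDiffAt, Finset.sum_eq_single m,
    iteratedDeriv_sub_pow_smul hψu (hfu m)]
  · intro j _ hj
    rcases lt_or_gt_of_ne hj with hj | hj
    · simp [h0 j hj]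
    · exact iteratedDeriv_eq_zero_of_lt_order (han j)
        (le_analyticOrderAt_sub_pow_smul hψu (hfu j) j) hj
  · simp

theorem sum_ite_sub {M : Type*} [AddCommMonoid M] {n : ℕ} (j : Fin n) (F : ℕ → M) :
    ∑ m : Fin n, (if j ≤ m then F (m - j) else 0) = ∑ k ∈ Finset.range (n - j), F k := by
  have h := Fin.sum_univ_eq_sum_range (fun m : ℕ => if (j : ℕ) ≤ m then F (m - j) else 0) n
  simp only [Fin.le_def]
  rw [h, ← Finset.sum_filter]
  refine Finset.sum_bij' (fun m _ => m - j) (fun k _ => k + j) ?_ ?_ ?_ ?_ ?_ <;>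
    simp only [Finset.mem_filter, Finset.mem_range] <;> intros <;>
    first | omega | rfl | trivial

/-- The effect on the generating functions of the multiplication of the array by `a ∘ ψ`. -/
def rochbergMul (ψ : ℂ → ℂ) (a : AInfty) (f : Fin n → ℂ → E) (m : Fin n) (z : ℂ) : E :=
  ∑ j : Fin n, if j ≤ m then (AInfty.reversedTaylor (m - j) a).eval (ψ z) • f j z else 0

/-- At fixed `u` the factor is a constant, so it may be moved inside the Taylor array and expanded
there in powers of `ψ z - ψ u`; collecting equal powers gives the convolution `rochbergMul`. -/
theorem smul_rochbergArray [CompleteSpace E] (hU : IsOpen U) (hψ : DifferentiableOn ℂ ψ U)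
    (hm : MapsTo ψ U unitDisc) (a : AInfty) (hf : ∀ j, IsAnalyticFun U (f j)) (hu : u ∈ U) :
    a.eval (ψ u) • rochbergArray U ψ f u = rochbergArray U ψ (rochbergMul ψ a f) u := by
  have hψu := hψ.analyticAt (hU.mem_nhds hu)
  have hfu := fun j => (hf j).analyticAt hU hu
  -- The expansion for the `j`-th summand stops after `n - j` terms: the prefactor already has order
  -- `j`, so the leftover has order at least `n` and a zero array.
  have hsum : ∀ z, a.eval (ψ u) • rochbergSum ψ f u z = rochbergSum ψ (rochbergMul ψ a f) u z +
      ∑ j : Fin n, (ψ z - ψ u) ^ (j : ℕ) • (a.remainder (ψ u) (n - j) (ψ z) • f j z) := by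
    intro z
    simp only [rochbergSum, rochbergMul, Finset.smul_sum]
    rw [Finset.sum_comm, ← Finset.sum_add_distrib]
    refine Finset.sum_congr rfl fun j _ => ?_
    have h := sum_ite_sub j fun k => (ψ z - ψ u) ^ (j : ℕ) •
      (((ψ z - ψ u) ^ k * (AInfty.reversedTaylor k a).eval (ψ z)) • f j z)
    have h1 : ∀ m : Fin n, (ψ z - ψ u) ^ (m : ℕ) •
        (if j ≤ m then (AInfty.reversedTaylor (m - j) a).eval (ψ z) • f j z else 0) =
        if j ≤ m then (ψ z - ψ u) ^ (j : ℕ) • (((ψ z - ψ u) ^ ((m : ℕ) - j) *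
          (AInfty.reversedTaylor (m - j) a).eval (ψ z)) • f j z) else 0 := by
      intro m
      split_ifs with hjm
      · rw [smul_smul, smul_smul, ← mul_assoc, ← pow_add, Nat.add_sub_cancel' hjm]
      · exact smul_zero _
    rw [Finset.sum_congr rfl fun m _ => h1 m, h, ← Finset.smul_sum, ← Finset.sum_smul, ← smul_add,
      ← add_smul, AInfty.remainder, add_sub_cancel, smul_comm]
  have hrem : ∀ j : Fin n, AnalyticAt ℂ (fun z => a.remainder (ψ u) (n - j) (ψ z) • f j z) u :=
    fun j => (AInfty.analyticAt_remainder_comp a hU hψ hm hu (ψ u) _).smul (hfu j)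
  have hterm : ∀ j : Fin n, AnalyticAt ℂ (fun z => (ψ z - ψ u) ^ (j : ℕ) •
      (a.remainder (ψ u) (n - j) (ψ z) • f j z)) u :=
    fun j => ((hψu.sub analyticAt_const).pow j).smul (hrem j)
  have hmul : ∀ m, AnalyticAt ℂ (rochbergMul ψ a f m) u := fun m =>
    Finset.analyticAt_fun_sum _ fun j _ => by
      split_ifs
      · exact (AInfty.analyticAt_eval_comp _ hU hψ hm hu).smul (hfu j)
      · exact analyticAt_const
  rw [rochbergArray, ← taylorArray_smul, rochbergArray]
  have hfun : a.eval (ψ u) • rochbergSum ψ f u = rochbergSum ψ (rochbergMul ψ a f) u +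
      fun z => ∑ j : Fin n, (ψ z - ψ u) ^ (j : ℕ) •
        (a.remainder (ψ u) (n - j) (ψ z) • f j z) := funext hsum
  rw [hfun, taylorArray_add (analyticAt_rochbergSum hψu hmul u)
    (Finset.analyticAt_fun_sum _ fun j _ => hterm j), taylorArray_sum _ fun j _ => hterm j,
    Finset.sum_eq_zero, add_zero]
  intro j _
  refine taylorArray_eq_zero_of_le_order (hterm j) ?_
  have h1 : AnalyticAt ℂ (fun z => (ψ z - ψ u) ^ (j : ℕ)) u := (hψu.sub analyticAt_const).pow j
  have h2 := analyticOrderAt_smul h1 (hrem j)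
  have h3 := analyticOrderAt_smul (AInfty.analyticAt_remainder_comp a hU hψ hm hu (ψ u) (n - j))
    (hfu j)
  have h4 : ((j : ℕ) : ℕ∞) ≤ analyticOrderAt (fun z => (ψ z - ψ u) ^ (j : ℕ)) u := by
    simpa using le_analyticOrderAt_sub_pow_smul hψu (g := fun _ => (1 : ℂ)) analyticAt_const j
  have h5 := AInfty.le_analyticOrderAt_remainder_comp a hU hψ hm hu (n - j)
  have h6 : (n : ℕ∞) = ((j : ℕ) : ℕ∞) + ((n - j : ℕ) : ℕ∞) := by
    exact_mod_cast (Nat.add_sub_cancel' j.2.le).symm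
  rw [h6]
  refine (add_le_add h4 (h5.trans ?_)).trans_eq h2.symm
  exact le_self_add.trans_eq h3.symm

end rochbergArray

/-! ### Bounded operators on `F` and on tuples -/

namespace AnalyticFunctionSpace

variable {U : Set ℂ} {ψ : ℂ → ℂ} {F : AnalyticFunctionSpace U E}

theorem Elem.isAnalyticFun (f : F.Elem) : IsAnalyticFun U f.toFun := F.isAnalyticFun _ f.2

/-- The functions underlying the elements of the space, as a linear map. -/
def toFunLinear (F : AnalyticFunctionSpace U E) : F.Elem →ₗ[ℂ] ℂ → E := F.carrier.subtype

theorem toFunLinear_apply (f : F.Elem) : F.toFunLinear f = f.toFun := rfl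

theorem Elem.toFun_injective : Function.Injective (Elem.toFun : F.Elem → ℂ → E) :=
  Subtype.val_injective

/-- Each derivative is a pointwise limit of difference quotients of continuous operators, hence
continuous by Banach–Steinhaus. -/
theorem exists_clm_iteratedDeriv [CompleteSpace E] (hU : IsOpen U) [CompleteSpace F.Elem]
    (hev : ∀ z ∈ U, Continuous fun f : F.Elem => f.toFun z) (i : ℕ) :
    ∀ z ∈ U, ∃ L : F.Elem →L[ℂ] E, ∀ f, L f = iteratedDeriv i f.toFun z := by
  induction i with
  | zero =>
    intro z hz
    exact ⟨⟨LinearMap.proj z ∘ₗ F.toFunLinear, hev z hz⟩, fun f => by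
      rw [iteratedDeriv_zero]
      rfl⟩
  | succ i ih =>
    intro z hz
    choose! L hL using ih
    have hlim : Tendsto (fun w (f : F.Elem) => ((w - z)⁻¹ • (L w - L z)) f) (𝓝[≠] z)
        (𝓝 fun f => iteratedDeriv (i + 1) f.toFun z) := by
      refine tendsto_pi_nhds.2 fun f => ?_
      have h1 : AnalyticAt ℂ (iteratedDeriv i f.toFun) z := by
        rw [iteratedDeriv_eq_iterate]
        exact (f.isAnalyticFun.analyticAt hU hz).iterated_deriv i
      have h2 := hasDerivAt_iff_tendsto_slope.1 h1.differentiableAt.hasDerivAt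
      rw [iteratedDeriv_succ]
      refine h2.congr' ?_
      filter_upwards [mem_nhdsWithin_of_mem_nhds (hU.mem_nhds hz)] with w hw
      simp [slope, hL w hw f, hL z hz f]
    exact ⟨continuousLinearMapOfTendsto _ hlim, fun f => rfl⟩

theorem continuous_taylorArray [CompleteSpace E] (hU : IsOpen U) [CompleteSpace F.Elem]
    (hev : ∀ z ∈ U, Continuous fun f : F.Elem => f.toFun z) (n : ℕ) {u : ℂ} (hu : u ∈ U) :
    Continuous fun f : F.Elem => taylorArray U n f.toFun u := by
  refine continuous_pi fun i => ?_
  obtain ⟨L, hL⟩ := exists_clm_iteratedDeriv hU hev i u hu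
  simp only [taylorArray_apply hu, ← hL]
  exact L.continuous.const_smul _

section action

variable (h : ∀ (a : AInfty) (f : F.Elem), (fun z => a.eval (ψ z) • f.toFun z) ∈ F.carrier)

/-- Multiplication by `a ∘ ψ` as a linear map. -/
def mulLinear (a : AInfty) : F.Elem →ₗ[ℂ] F.Elem where
  toFun f := ⟨_, h a f⟩
  map_add' _ _ := Elem.toFun_injective (funext fun _ => smul_add _ _ _)
  map_smul' _ _ := Elem.toFun_injective (funext fun _ => smul_comm _ _ _)

/-- The tuple whose array is the product with `a ∘ ψ` of the array of `f`. -/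
def mulTuple {n : ℕ} (a : AInfty) (f : Fin n → F.Elem) (m : Fin n) : F.Elem :=
  ∑ j : Fin n, if j ≤ m then mulLinear h (AInfty.reversedTaylor (m - j) a) (f j) else 0

theorem mulTuple_toFun {n : ℕ} (a : AInfty) (f : Fin n → F.Elem) (m : Fin n) :
    (mulTuple h a f m).toFun = rochbergMul ψ a (fun j => (f j).toFun) m := by
  funext z
  rw [mulTuple, ← toFunLinear_apply, map_sum, Finset.sum_apply]
  refine Finset.sum_congr rfl fun j _ => ?_
  split_ifs
  · rfl
  · rw [map_zero, Pi.zero_apply]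

/-- `mulTuple` as a linear map. -/
def mulTupleLinear (n : ℕ) (a : AInfty) : (Fin n → F.Elem) →ₗ[ℂ] (Fin n → F.Elem) where
  toFun := mulTuple h a
  map_add' f g := by
    funext m
    simp only [mulTuple, Pi.add_apply, map_add, ← Finset.sum_add_distrib]
    refine Finset.sum_congr rfl fun j _ => ?_
    split_ifs <;> simp
  map_smul' c f := by
    funext m
    simp only [mulTuple, Pi.smul_apply, map_smul, RingHom.id_apply, Finset.smul_sum]
    refine Finset.sum_congr rfl fun j _ => ?_
    split_ifs <;> simp

/-- Isolates the diagonal of the triangular action, which is what forward substitution inverts. -/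
theorem mulTuple_apply_eq {n : ℕ} (a : AInfty) (f : Fin n → F.Elem) (m : Fin n) :
    mulTuple h a f m = mulLinear h a (f m) +
      ∑ j ∈ Finset.univ.filter (· < m), mulLinear h (AInfty.reversedTaylor (m - j) a) (f j) := by
  rw [mulTuple, ← Finset.sum_filter]
  have h1 : Finset.univ.filter (· ≤ m) = insert m (Finset.univ.filter (· < m)) := by
    ext j
    simp [le_iff_eq_or_lt]
  rw [h1, Finset.sum_insert (by simp), Nat.sub_self]
  rfl

variable [CompleteSpace F.Elem]
  (hev : ∀ z ∈ U, Continuous fun f : F.Elem => f.toFun z)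

/-- Multiplication by `a ∘ ψ` as a continuous linear map. It is continuous for the norm by the closed
graph theorem, because the evaluations are. -/
def mulCLM (a : AInfty) : F.Elem →L[ℂ] F.Elem :=
  ⟨mulLinear h a, by
    refine (mulLinear h a).continuous_of_seq_closed_graph fun s f g hs hg => ?_
    refine Elem.toFun_injective (funext fun z => ?_)
    by_cases hz : z ∈ U
    · refine tendsto_nhds_unique (((hev z hz).tendsto g).comp hg) ?_
      exact (((hev z hz).tendsto f).comp hs).const_smul (a.eval (ψ z))
    · rw [g.isAnalyticFun.2 z hz, Elem.isAnalyticFun _ |>.2 z hz]⟩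

/-- Multiplication by `ψ - ψ u`. -/
def shiftCLM (u : ℂ) : F.Elem →L[ℂ] F.Elem :=
  mulCLM h hev AInfty.coord - ψ u • ContinuousLinearMap.id ℂ F.Elem

theorem shiftCLM_toFun (u : ℂ) (f : F.Elem) (z : ℂ) :
    (shiftCLM h hev u f).toFun z = (ψ z - ψ u) • f.toFun z := by
  change AInfty.coord.eval (ψ z) • f.toFun z - ψ u • f.toFun z = _
  rw [AInfty.eval_coord, sub_smul]

theorem shiftCLM_pow_toFun (u : ℂ) (j : ℕ) (f : F.Elem) (z : ℂ) :
    ((shiftCLM h hev u ^ j) f).toFun z = (ψ z - ψ u) ^ j • f.toFun z := by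
  induction j generalizing f with
  | zero => simp
  | succ j ih =>
    rw [pow_succ, mul_apply_eq_comp, ih, shiftCLM_toFun, smul_smul, pow_succ]

/-- The continuous linear map sending `f` to `∑ j, (ψ - ψ u) ^ j • f j`. -/
def sumCLM (n : ℕ) (u : ℂ) : (Fin n → F.Elem) →L[ℂ] F.Elem :=
  ∑ j : Fin n, (shiftCLM h hev u ^ (j : ℕ)) ∘L ContinuousLinearMap.proj j

theorem sumCLM_toFun (n : ℕ) (u : ℂ) (f : Fin n → F.Elem) :
    (sumCLM h hev n u f).toFun = rochbergSum ψ (fun j => (f j).toFun) u := by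
  funext z
  simp only [sumCLM, sum_apply, ContinuousLinearMap.comp_apply,
    ContinuousLinearMap.proj_apply, rochbergSum]
  rw [← toFunLinear_apply, map_sum, Finset.sum_apply]
  exact Finset.sum_congr rfl fun j _ => shiftCLM_pow_toFun h hev u j (f j) z

/-- `mulTuple` as a continuous linear map. -/
def mulTupleCLM (n : ℕ) (a : AInfty) : (Fin n → F.Elem) →L[ℂ] (Fin n → F.Elem) :=
  ⟨mulTupleLinear h n a, by
    refine continuous_pi fun m => ?_
    have h1 : Continuous fun f : Fin n → F.Elem => ∑ j : Fin n,
        if j ≤ m then mulCLM h hev (AInfty.reversedTaylor (m - j) a) (f j) else 0 := by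
      refine continuous_finsetSum _ fun j _ => ?_
      split_ifs
      · exact (mulCLM h hev _).continuous.comp (continuous_apply j)
      · exact continuous_const
    exact h1⟩

theorem mulTupleCLM_apply (n : ℕ) (a : AInfty) (f : Fin n → F.Elem) :
    mulTupleCLM h hev n a f = mulTuple h a f := rfl

include hev in
/-- If multiplication by `a ∘ ψ` is bounded below on the space, it is bounded below on tuples. -/
theorem exists_norm_le_mulTuple (a : AInfty) {K : ℝ} (hK : 0 ≤ K)
    (hbelow : ∀ f : F.Elem, ‖f‖ ≤ K * ‖mulLinear h a f‖) (n : ℕ) :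
    ∃ C : ℝ, 0 ≤ C ∧ ∀ f : Fin n → F.Elem, ‖f‖ ≤ C * ‖mulTuple h a f‖ := by
  -- Forward substitution: once the entries before `m` are bounded, the triangular formula bounds `a
  -- ∘ ψ` times the `m`-th entry, and `hbelow` bounds the entry itself.
  have key : ∀ m ≤ n, ∃ C : ℝ, 0 ≤ C ∧ ∀ f : Fin n → F.Elem, ∀ j : Fin n, (j : ℕ) < m →
      ‖f j‖ ≤ C * ‖mulTuple h a f‖ := by
    intro m
    induction m with
    | zero => exact fun _ => ⟨0, le_rfl, fun f j hj => absurd hj (Nat.not_lt_zero _)⟩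
    | succ m ih =>
      intro hm
      obtain ⟨C, hC, hCb⟩ := ih (Nat.le_of_succ_le hm)
      set i : Fin n := ⟨m, hm⟩
      set B : ℝ := ∑ j ∈ Finset.univ.filter (· < i),
        ‖mulCLM h hev (AInfty.reversedTaylor (i - j) a)‖ with hB
      have hB0 : 0 ≤ B := Finset.sum_nonneg fun _ _ => norm_nonneg _
      refine ⟨C + K * (1 + B * C), by positivity, fun f j hj => ?_⟩
      rcases Nat.lt_succ_iff_lt_or_eq.1 hj with hj | hj
      · refine (hCb f j hj).trans ?_
        gcongr
        have : 0 ≤ K * (1 + B * C) := by positivity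
        linarith
      · obtain rfl : j = i := Fin.ext hj
        have h1 : ‖mulLinear h a (f i)‖ ≤ ‖mulTuple h a f‖ + B * (C * ‖mulTuple h a f‖) := by
          rw [eq_sub_of_add_eq (mulTuple_apply_eq h a f i).symm]
          refine (norm_sub_le _ _).trans (add_le_add (norm_le_pi_norm _ i) ?_)
          rw [hB, Finset.sum_mul]
          refine (norm_sum_le _ _).trans (Finset.sum_le_sum fun k hk => ?_)
          refine ((mulCLM h hev (AInfty.reversedTaylor (i - k) a)).le_opNorm (f k)).trans ?_
          gcongr
          exact hCb f k (Finset.mem_filter.1 hk).2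
        refine (hbelow (f i)).trans ?_
        calc K * ‖mulLinear h a (f i)‖
            ≤ K * (‖mulTuple h a f‖ + B * (C * ‖mulTuple h a f‖)) := by gcongr
          _ = (K * (1 + B * C)) * ‖mulTuple h a f‖ := by ring
          _ ≤ (C + K * (1 + B * C)) * ‖mulTuple h a f‖ := by gcongr; linarith
  obtain ⟨C, hC, hCb⟩ := key n le_rfl
  exact ⟨C, hC, fun f => (pi_norm_le_iff_of_nonneg (by positivity)).2 fun j => hCb f j j.2⟩

end action

/-! ### The space of arrays -/

section rochbergSpace

variable [CompleteSpace E]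

/-- The linear map sending a tuple of elements of the space to its array. -/
def rochbergMap (F : AnalyticFunctionSpace U E) (hU : IsOpen U) (hψ : DifferentiableOn ℂ ψ U)
    (n : ℕ) : (Fin n → F.Elem) →ₗ[ℂ] ℂ → Fin n → E where
  toFun f := rochbergArray U ψ fun j => (f j).toFun
  map_add' f g := rochbergArray_add hU hψ (fun j => (f j).isAnalyticFun)
    fun j => (g j).isAnalyticFun
  map_smul' c f := rochbergArray_smul c fun j => (f j).toFun

theorem rochbergMap_apply (hU : IsOpen U) (hψ : DifferentiableOn ℂ ψ U) {n : ℕ}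
    (f : Fin n → F.Elem) :
    F.rochbergMap hU hψ n f = rochbergArray U ψ fun j => (f j).toFun := rfl

theorem isAnalyticFun_rochbergMap (hU : IsOpen U) (hψ : DifferentiableOn ℂ ψ U) {n : ℕ}
    (f : Fin n → F.Elem) : IsAnalyticFun U (F.rochbergMap hU hψ n f) :=
  isAnalyticFun_rochbergArray hU hψ fun j => (f j).isAnalyticFun

theorem rochbergMap_apply_of_forall_lt (hU : IsOpen U) (hψ : DifferentiableOn ℂ ψ U) {n : ℕ}
    (f : Fin n → F.Elem) (m : Fin n) (h0 : ∀ j < m, f j = 0) {u : ℂ} (hu : u ∈ U) :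
    F.rochbergMap hU hψ n f u m = deriv ψ u ^ (m : ℕ) • (f m).toFun u :=
  rochbergArray_apply_of_forall_lt hU hψ (fun j => (f j).isAnalyticFun) m
    (fun j hj => by simp only [h0 j hj]; rfl) hu

/-- By triangularity: the first entry not yet known to vanish appears alone in its coordinate, with
a nonvanishing factor. -/
theorem rochbergMap_injective (hU : IsOpen U) (hψ : DifferentiableOn ℂ ψ U)
    (hd : ∀ u ∈ U, deriv ψ u ≠ 0) (n : ℕ) : Function.Injective (F.rochbergMap hU hψ n) := by
  refine (injective_iff_map_eq_zero _).2 fun f hf => funext fun m => ?_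
  induction m using WellFoundedLT.induction with
  | ind m ih =>
    refine Elem.toFun_injective (funext fun u => ?_)
    change (f m).toFun u = 0
    by_cases hu : u ∈ U
    · have h1 := rochbergMap_apply_of_forall_lt hU hψ f m ih hu
      rw [hf] at h1
      exact (smul_eq_zero.1 h1.symm).resolve_left (pow_ne_zero _ (hd u hu))
    · exact (f m).isAnalyticFun.2 u hu

/-- The space of the arrays of tuples of elements of `F`, with the supremum norm of tuples. -/
def rochbergSpace (F : AnalyticFunctionSpace U E) (hU : IsOpen U) (hψ : DifferentiableOn ℂ ψ U)
    (hd : ∀ u ∈ U, deriv ψ u ≠ 0) (n : ℕ) : AnalyticFunctionSpace U (Fin n → E) where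
  carrier := LinearMap.range (F.rochbergMap hU hψ n)
  isAnalyticFun := by
    rintro _ ⟨f, rfl⟩
    exact isAnalyticFun_rochbergMap hU hψ f
  nrm := (normSeminorm ℂ (Fin n → F.Elem)).comp
    (LinearEquiv.ofInjective _ (rochbergMap_injective hU hψ hd n)).symm.toLinearMap
  eq_zero_of_nrm f hf := by
    have h1 : ‖(LinearEquiv.ofInjective _ (rochbergMap_injective hU hψ hd n)).symm f‖ = 0 := hf
    exact (LinearEquiv.map_eq_zero_iff _).1 (norm_eq_zero.1 h1)

/-- The identification of the space of arrays with the space of tuples. -/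
def rochbergIsometry (F : AnalyticFunctionSpace U E) (hU : IsOpen U)
    (hψ : DifferentiableOn ℂ ψ U) (hd : ∀ u ∈ U, deriv ψ u ≠ 0) (n : ℕ) :
    (Fin n → F.Elem) ≃ₗᵢ[ℂ] (F.rochbergSpace hU hψ hd n).Elem where
  toLinearEquiv := LinearEquiv.ofInjective _ (rochbergMap_injective hU hψ hd n)
  norm_map' f := by
    change ‖(LinearEquiv.ofInjective _ (rochbergMap_injective hU hψ hd n)).symm
      (LinearEquiv.ofInjective _ (rochbergMap_injective hU hψ hd n) f)‖ = ‖f‖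
    rw [LinearEquiv.symm_apply_apply]

variable (hU : IsOpen U) (hψ : DifferentiableOn ℂ ψ U) (hd : ∀ u ∈ U, deriv ψ u ≠ 0) {n : ℕ}

/-- Reduces evaluation at `u` to a bounded operator into `F` followed by a Taylor array; both the
continuity of evaluations and the fibre comparison rest on this. -/
theorem rochbergMap_eq_taylorArray
    (h : ∀ (a : AInfty) (f : F.Elem), (fun z => a.eval (ψ z) • f.toFun z) ∈ F.carrier)
    [CompleteSpace F.Elem] (hev : ∀ z ∈ U, Continuous fun f : F.Elem => f.toFun z)
    (f : Fin n → F.Elem) (u : ℂ) :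
    F.rochbergMap hU hψ n f u = taylorArray U n (sumCLM h hev n u f).toFun u := by
  rw [sumCLM_toFun]
  rfl

theorem smul_rochbergMap (hm : MapsTo ψ U unitDisc)
    (h : ∀ (a : AInfty) (f : F.Elem), (fun z => a.eval (ψ z) • f.toFun z) ∈ F.carrier)
    (a : AInfty) (f : Fin n → F.Elem) :
    (fun z => a.eval (ψ z) • F.rochbergMap hU hψ n f z) =
      F.rochbergMap hU hψ n (mulTuple h a f) := by
  funext z
  by_cases hz : z ∈ U
  · simp only [rochbergMap_apply, mulTuple_toFun]
    exact smul_rochbergArray hU hψ hm a (fun j => (f j).isAnalyticFun) hz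
  · simp only [rochbergMap_apply, rochbergArray_of_notMem hz, smul_zero]

theorem rochbergMap_single_zero (hn : 0 < n) (f : F.Elem) :
    F.rochbergMap hU hψ n (Pi.single ⟨0, hn⟩ f) = taylorArray U n f.toFun := by
  funext u
  rw [rochbergMap_apply, rochbergArray]
  congr 1
  funext z
  rw [rochbergSum, Finset.sum_eq_single (⟨0, hn⟩ : Fin n)]
  · simp
  · intro j _ hj
    rw [Pi.single_eq_of_ne hj]
    exact smul_zero _
  · simp

end rochbergSpace

end AnalyticFunctionSpace

/-! ### Acceptability of the space of arrays and its fibres -/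

namespace AnalyticFunctionSpace

variable {U : Set ℂ} {ψ : ℂ → ℂ} {F : AnalyticFunctionSpace U E} [CompleteSpace E]
  (hU : IsOpen U) (hψ : DifferentiableOn ℂ ψ U) (hd : ∀ u ∈ U, deriv ψ u ≠ 0) {n : ℕ}

theorem nrm_rochbergMap (f : Fin n → F.Elem)
    (hf : F.rochbergMap hU hψ n f ∈ (F.rochbergSpace hU hψ hd n).carrier) :
    (F.rochbergSpace hU hψ hd n).nrm ⟨F.rochbergMap hU hψ n f, hf⟩ = ‖f‖ :=
  (F.rochbergIsometry hU hψ hd n).norm_map f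

omit [CompleteSpace E] in
theorem isAnalyticFun_coord {g : ℂ → Fin n → E} (hg : IsAnalyticFun U g) (i : Fin n) :
    IsAnalyticFun U fun z => g z i :=
  ⟨differentiableOn_pi.1 hg.1 i, fun z hz => by simp [hg.2 z hz]⟩

include hd in
/-- Division of arrays by a multiplier for which division is possible in `F`. -/
theorem exists_rochbergMap_eq (hm : MapsTo ψ U unitDisc)
    (h : ∀ (a : AInfty) (f : F.Elem), (fun z => a.eval (ψ z) • f.toFun z) ∈ F.carrier)
    (a : AInfty)
    (hdiv : ∀ f : ℂ → E, IsAnalyticFun U f → (fun z => a.eval (ψ z) • f z) ∈ F.carrier →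
      f ∈ F.carrier)
    (hzero : ∀ f : F.Elem, mulLinear h a f = 0 → f = 0)
    {g : ℂ → Fin n → E} (hg : IsAnalyticFun U g) {f : Fin n → F.Elem}
    (hgf : (fun z => a.eval (ψ z) • g z) = F.rochbergMap hU hψ n f) :
    ∃ f', F.rochbergMap hU hψ n f' = g := by
  -- Induction on the number `k` of final entries of `f` that may be nonzero.
  suffices H : ∀ k ≤ n, ∀ g : ℂ → Fin n → E, IsAnalyticFun U g → ∀ f : Fin n → F.Elem,
      (∀ j : Fin n, (j : ℕ) + k < n → f j = 0) →
      (fun z => a.eval (ψ z) • g z) = F.rochbergMap hU hψ n f →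
      ∃ f', F.rochbergMap hU hψ n f' = g from
    H n le_rfl g hg f (fun j hj => absurd hj (by omega)) hgf
  intro k
  induction k with
  | zero =>
    intro _ g hg f hf hgf
    have hf0 : f = 0 := funext fun j => hf j j.2
    rw [hf0, map_zero] at hgf
    refine ⟨0, ?_⟩
    rw [map_zero]
    funext z i
    -- The zero function lies in `F`, so `hdiv` places each coordinate of `g` in `F`, where `hzero`
    -- kills it.
    have h1 : (fun z => a.eval (ψ z) • g z i) = 0 := funext fun z => congrFun (congrFun hgf z) i
    have h2 := hdiv _ (isAnalyticFun_coord hg i) (h1 ▸ F.carrier.zero_mem)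
    have h3 := hzero ⟨_, h2⟩ (Elem.toFun_injective h1)
    exact (congrFun (congrArg Elem.toFun h3) z).symm
  | succ k ih =>
    intro hk g hg f hf hgf
    set m : Fin n := ⟨n - (k + 1), by omega⟩ with hmdef
    have hfm : ∀ j < m, f j = 0 := fun j hj => hf j (by
      have : (j : ℕ) < n - (k + 1) := hj
      omega)
    -- The candidate for the `m`-th entry of the quotient: the leading coordinate of `g` with its
    -- factor `ψ'^m` removed. Its product with `a ∘ ψ` is `f m`, so `hdiv` applies.
    set e : ℂ → E := fun z => (deriv ψ z ^ (m : ℕ))⁻¹ • g z m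
    have he : IsAnalyticFun U e := by
      refine ⟨DifferentiableOn.smul (DifferentiableOn.inv ?_ fun z hz => pow_ne_zero _ (hd z hz))
        (isAnalyticFun_coord hg m).1, fun z hz => by simp [e, hg.2 z hz]⟩
      exact (hψ.deriv hU).pow _
    have hae : (fun z => a.eval (ψ z) • e z) = (f m).toFun := by
      funext z
      by_cases hz : z ∈ U
      · have h1 := rochbergMap_apply_of_forall_lt hU hψ f m hfm hz
        rw [← hgf] at h1
        have h2 : a.eval (ψ z) • g z m = deriv ψ z ^ (m : ℕ) • (f m).toFun z := h1
        simp only [e]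
        rw [smul_comm, h2, inv_smul_smul₀ (pow_ne_zero _ (hd z hz))]
      · rw [he.2 z hz, (f m).isAnalyticFun.2 z hz, smul_zero]
    obtain ⟨e', he'⟩ : ∃ e' : F.Elem, e'.toFun = e := ⟨⟨e, hdiv e he (by
      rw [hae]
      exact (f m).2)⟩, rfl⟩
    rw [← he'] at hae
    set x : Fin n → F.Elem := Pi.single m e' with hx
    have hg' : IsAnalyticFun U (g - F.rochbergMap hU hψ n x) := by
      have hx' := isAnalyticFun_rochbergMap hU hψ x
      exact ⟨hg.1.sub hx'.1, fun z hz => by simp [hg.2 z hz, hx'.2 z hz]⟩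
    -- Subtracting the array of `x` from `g` changes `f` by `mulTuple h a x`, which is zero before
    -- `m` and equal to `f m` at `m`: one more entry is cleared.
    have hvanish : ∀ j : Fin n, (j : ℕ) + k < n → (f - mulTuple h a x) j = 0 := by
      intro j hj
      have hjm : j ≤ m := by
        change (j : ℕ) ≤ n - (k + 1)
        omega
      rw [Pi.sub_apply, mulTuple_apply_eq, Finset.sum_eq_zero, add_zero, sub_eq_zero]
      · rcases hjm.lt_or_eq with hlt | rfl
        · rw [hfm j hlt, hx, Pi.single_eq_of_ne hlt.ne, map_zero]
        · rw [hx, Pi.single_eq_same]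
          exact Elem.toFun_injective hae.symm
      · intro i hi
        have him : i < m := (Finset.mem_filter.1 hi).2.trans_le hjm
        rw [hx, Pi.single_eq_of_ne him.ne, map_zero]
    have hmul : (fun z => a.eval (ψ z) • (g - F.rochbergMap hU hψ n x) z) =
        F.rochbergMap hU hψ n (f - mulTuple h a x) := by
      rw [map_sub, ← smul_rochbergMap hU hψ hm h a x, ← hgf]
      funext z
      simp [smul_sub]
    obtain ⟨f', hf'⟩ := ih (by omega) _ hg' _ hvanish hmul
    exact ⟨f' + x, by rw [map_add, hf', sub_add_cancel]⟩

theorem continuous_eval_rochbergSpace (hF : F.IsAcceptable)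
    (h : ∀ (a : AInfty) (f : F.Elem), (fun z => a.eval (ψ z) • f.toFun z) ∈ F.carrier)
    {z : ℂ} (hz : z ∈ U) :
    Continuous fun f : (F.rochbergSpace hU hψ hd n).Elem => f.toFun z := by
  have := hF.complete
  have h1 : Continuous fun f : Fin n → F.Elem =>
      taylorArray U n (sumCLM h hF.continuous_eval n z f).toFun z :=
    (continuous_taylorArray hU hF.continuous_eval n hz).comp
      (sumCLM h hF.continuous_eval n z).continuous
  refine (h1.comp (F.rochbergIsometry hU hψ hd n).symm.continuous).congr fun g => ?_
  obtain ⟨f, rfl⟩ := (F.rochbergIsometry hU hψ hd n).surjective g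
  rw [Function.comp_apply, LinearIsometryEquiv.symm_apply_apply,
    ← rochbergMap_eq_taylorArray hU hψ]
  rfl

theorem IsAcceptable.rochbergSpace (hF : F.IsAcceptable) (hψc : IsConformalEquiv U unitDisc ψ)
    (h : ∀ (a : AInfty) (f : F.Elem), (fun z => a.eval (ψ z) • f.toFun z) ∈ F.carrier) :
    (F.rochbergSpace hU hψ hd n).IsAcceptable where
  complete := by
    have := hF.complete
    exact (completeSpace_congr (e := (F.rochbergIsometry hU hψ hd n).toEquiv)
      (F.rochbergIsometry hU hψ hd n).isometry.isUniformEmbedding).1 inferInstance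
  continuous_eval z hz := continuous_eval_rochbergSpace hU hψ hd hF h hz
  module := by
    refine ⟨ψ, hψc, ?_, ?_⟩
    · rintro a ⟨_, f, rfl⟩
      exact ⟨mulTuple h a f, (smul_rochbergMap hU hψ hψc.2.1 h a f).symm⟩
    -- The topology on the target is the one induced by pointwise convergence, so joint continuity
    -- is tested on values and follows from continuity of both evaluations.
    · refine continuous_induced_rng.2 (continuous_pi fun z => ?_)
      by_cases hz : z ∈ U
      · exact ((AInfty.continuous_eval (hψc.2.1 hz)).comp continuous_fst).smul
          ((continuous_eval_rochbergSpace hU hψ hd hF h hz).comp continuous_snd)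
      · refine continuous_const.congr (f := fun _ => 0) fun p => ?_
        change 0 = p.1.eval (ψ z) • p.2.toFun z
        rw [p.2.isAnalyticFun.2 z hz, smul_zero]
  conformal φ hφ := by
    have := hF.complete
    have hev := hF.continuous_eval
    obtain ⟨K, hK, hFK⟩ := hF.conformal φ hφ
    obtain ⟨a, ha⟩ := hφ.exists_eval_comp hψc
    have hmul : ∀ {V : Type _} [NormedAddCommGroup V] [NormedSpace ℂ V] (g : ℂ → V),
        IsAnalyticFun U g → (fun z => φ z • g z) = fun z => a.eval (ψ z) • g z := by
      intro V _ _ g hg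
      funext z
      by_cases hz : z ∈ U
      · rw [ha z hz]
      · rw [hg.2 z hz, smul_zero, smul_zero]
    have hbelow : ∀ f : F.Elem, ‖f‖ ≤ K * ‖mulLinear h a f‖ := by
      intro f
      have h1 := hmul f.toFun f.isAnalyticFun
      have h2 := ((hFK f.toFun f.isAnalyticFun).2 f.2 (h1 ▸ h a f)).2
      refine h2.trans_eq ?_
      congr 2
      exact Subtype.ext h1
    have hdiv : ∀ f : ℂ → E, IsAnalyticFun U f → (fun z => a.eval (ψ z) • f z) ∈ F.carrier →
        f ∈ F.carrier := fun f hf hm => (hFK f hf).1.1 (by rwa [hmul f hf])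
    have hzero : ∀ f : F.Elem, mulLinear h a f = 0 → f = 0 := fun f hf => by
      have := hbelow f
      rw [hf, norm_zero, mul_zero] at this
      exact norm_le_zero_iff.1 this
    obtain ⟨C, hC, hCb⟩ := exists_norm_le_mulTuple h hev a hK.le hbelow n
    -- One constant dominating the lower bound `C` and the operator norm; the 1 keeps it positive.
    refine ⟨C + ‖mulTupleCLM h hev n a‖ + 1, by positivity, fun g hg => ⟨⟨?_, ?_⟩, ?_⟩⟩
    · rintro ⟨f, hf⟩
      rw [hmul g hg] at hf
      exact exists_rochbergMap_eq hU hψ hd hψc.2.1 h a hdiv hzero hg hf.symm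
    · rintro ⟨f, rfl⟩
      exact ⟨mulTuple h a f, by rw [hmul _ hg, smul_rochbergMap hU hψ hψc.2.1 h]⟩
    · intro hgT hφf
      obtain ⟨f, rfl⟩ := id hgT
      have h1 : (fun z => φ z • F.rochbergMap hU hψ n f z) =
          F.rochbergMap hU hψ n (mulTuple h a f) := by
        rw [hmul _ hg, smul_rochbergMap hU hψ hψc.2.1 h]
      have h2 : (F.rochbergSpace hU hψ hd n).nrm ⟨_, hφf⟩ = ‖mulTuple h a f‖ := by
        rw [← nrm_rochbergMap hU hψ hd (mulTuple h a f) ⟨_, rfl⟩]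
        congr 1
        exact Subtype.ext h1
      rw [h2, nrm_rochbergMap hU hψ hd f hgT]
      have h3 := (mulTupleCLM h hev n a).le_opNorm f
      rw [mulTupleCLM_apply] at h3
      have h4 := norm_nonneg f
      have h5 := norm_nonneg (mulTuple h a f)
      have h6 := norm_nonneg (mulTupleCLM h hev n a)
      constructor
      · rw [inv_mul_le_iff₀ (by positivity)]
        nlinarith [mul_nonneg hC h4]
      · nlinarith [hCb f, mul_nonneg h6 h5]

omit [CompleteSpace E] in
/-- The values at a point of a space that contains the Taylor arrays of `F` isometrically, and whose
values are in a bounded way Taylor arrays of elements of `F`. -/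
theorem fiber_eq_rochberg {T : AnalyticFunctionSpace U (Fin n → E)} {u : ℂ}
    (hT : ∀ f : F.Elem, ∃ h : taylorArray U n f.toFun ∈ T.carrier,
      T.nrm ⟨taylorArray U n f.toFun, h⟩ = ‖f‖) {C : ℝ} (hC : 1 ≤ C)
    (hlift : ∀ g : T.Elem, ∃ f : F.Elem, taylorArray U n f.toFun u = g.toFun u ∧ ‖f‖ ≤ C * ‖g‖) :
    T.fiber u = F.rochberg n u ∧ ∃ C : ℝ, 0 < C ∧ ∀ w ∈ F.rochberg n u,
      C⁻¹ * F.rochbergNorm n u w ≤ T.fiberNorm u w ∧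
      T.fiberNorm u w ≤ C * F.rochbergNorm n u w := by
  have hC0 : 0 < C := one_pos.trans_le hC
  have hsub : ∀ w, {r | ∃ f : F.Elem, taylorArray U n f.toFun u = w ∧ r = ‖f‖} ⊆
      {r | ∃ g : T.Elem, g.toFun u = w ∧ r = ‖g‖} := by
    rintro w _ ⟨f, hf, rfl⟩
    obtain ⟨h1, h2⟩ := hT f
    exact ⟨⟨_, h1⟩, hf, h2.symm⟩
  have hbddT : ∀ w, BddBelow {r | ∃ g : T.Elem, g.toFun u = w ∧ r = ‖g‖} := fun w =>
    ⟨0, by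
      rintro _ ⟨g, -, rfl⟩
      exact norm_nonneg g⟩
  refine ⟨Set.ext fun w => ⟨?_, ?_⟩, C, hC0, ?_⟩
  · rintro ⟨g, rfl⟩
    obtain ⟨f, hf, -⟩ := hlift g
    exact ⟨f, hf⟩
  · rintro ⟨f, hf⟩
    exact ⟨⟨_, (hT f).1⟩, hf⟩
  · rintro w ⟨f, hf⟩
    have hne : {r | ∃ f : F.Elem, taylorArray U n f.toFun u = w ∧ r = ‖f‖}.Nonempty :=
      ⟨_, f, hf, rfl⟩
    constructor
    · refine le_csInf (hne.mono (hsub w)) ?_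
      rintro _ ⟨g, hg, rfl⟩
      obtain ⟨f', hf', hle⟩ := hlift g
      rw [inv_mul_le_iff₀ hC0]
      refine le_trans (csInf_le ((hbddT w).mono (hsub w)) ⟨f', hf'.trans hg, rfl⟩) hle
    · have h1 : T.fiberNorm u w ≤ F.rochbergNorm n u w :=
        csInf_le_csInf (hbddT w) hne (hsub w)
      have h2 : 0 ≤ F.rochbergNorm n u w := le_csInf hne fun _ ⟨f, _, hr⟩ => hr ▸ norm_nonneg f
      exact h1.trans (le_mul_of_one_le_left h2 hC)

end AnalyticFunctionSpace

end

/-! ### The theorem -/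

theorem mainTheorem1 {E : Type*} [NormedAddCommGroup E] [NormedSpace ℂ E] [CompleteSpace E]
    (U : Set ℂ) (hU : IsOpen U) (hUD : ∃ φ : ℂ → ℂ, IsConformalEquiv U unitDisc φ)
    (F : AnalyticFunctionSpace U E) (hF : F.IsAcceptable) (n : ℕ) (hn : 2 ≤ n) :
    ∃ T : AnalyticFunctionSpace U (Fin n → E), T.IsAcceptable ∧
      (∀ f : F.Elem, ∃ h : taylorArray U n f.toFun ∈ T.carrier,
        T.nrm ⟨taylorArray U n f.toFun, h⟩ = ‖f‖) ∧
      ∀ u ∈ U, T.fiber u = F.rochberg n u ∧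
        ∃ C : ℝ, 0 < C ∧ ∀ w ∈ F.rochberg n u,
          C⁻¹ * F.rochbergNorm n u w ≤ T.fiberNorm u w ∧
          T.fiberNorm u w ≤ C * F.rochbergNorm n u w := by
  obtain ⟨ψ, hψc, h, -⟩ := hF.module
  have := hF.complete
  have hev := hF.continuous_eval
  have hψ := hψc.1
  have hd : ∀ u ∈ U, deriv ψ u ≠ 0 := fun u hu => hψc.deriv_ne_zero hU Metric.isOpen_ball hu
  have hT : ∀ f : F.Elem, ∃ h : taylorArray U n f.toFun ∈ (F.rochbergSpace hU hψ hd n).carrier,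
      (F.rochbergSpace hU hψ hd n).nrm ⟨taylorArray U n f.toFun, h⟩ = ‖f‖ := by
    intro f
    have hn0 : 0 < n := by omega
    rw [← AnalyticFunctionSpace.rochbergMap_single_zero hU hψ hn0 f]
    exact ⟨⟨_, rfl⟩, (AnalyticFunctionSpace.nrm_rochbergMap hU hψ hd _ _).trans (Pi.norm_single _)⟩
  refine ⟨F.rochbergSpace hU hψ hd n, hF.rochbergSpace hU hψ hd hψc h, hT, fun u _ => ?_⟩
  refine AnalyticFunctionSpace.fiber_eq_rochberg hT
    -- The operator norm bounds the lifting to `F`; adding 1 gives `1 ≤ C`, since the opposite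
    -- inequality between the quotient norms holds with constant 1.
    (C := ‖AnalyticFunctionSpace.sumCLM h hev n u‖ + 1)
    (le_add_of_nonneg_left (norm_nonneg _)) fun g => ?_
  obtain ⟨f, rfl⟩ := (F.rochbergIsometry hU hψ hd n).surjective g
  refine ⟨AnalyticFunctionSpace.sumCLM h hev n u f,
    (AnalyticFunctionSpace.rochbergMap_eq_taylorArray hU hψ h hev f u).symm, ?_⟩
  rw [LinearIsometryEquiv.norm_map]
  refine ((AnalyticFunctionSpace.sumCLM h hev n u).le_opNorm f).trans ?_
  gcongr
  linarith
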